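/- Let $d\ge 1$, $n\ge 1$ be integers, $\varepsilon\in\mathbb R$, and let $\mathbb S^{d-1}=\{u\in\mathbb R^d:\|u\|_2=1\}$. **Definitions.** An $\varepsilon$-DP local randomizer from $\mathbb S^{d-1}$ to a measurable space $Y$ is a Markov kernel $R$, i.e. a measurable assignment of a probability law $R(v)$ on $Y$ to each $v\in\mathbb S^{d-1}$, such that $e^{-\varepsilon}P(R(v)\in E)\le P(R(v')\in E)\le e^{\varepsilon}P(R(v)\in E)$ for all $v,v'\in\mathbb S^{d-1}$ and all events $E\subseteq Y$. An aggregation is a measurable, possibly randomized, map $A$ from $Y^n$ to $\mathbb R^d$. In $A(R(v_1),\dots,R(v_n))$ the messages $R(v_i)$ are independent. The pair $(A,R)$ is unbiased if, for all $v_1,\dots,v_n\in\mathbb S^{d-1}$, the expectation $\mathbb E[A(R(v_1),\dots,R(v_n))]$ exists and equals $\frac1n\sum_{i=1}^n v_i$. Its error is $$\mathrm{err}_n(A,R)=\sup_{v_1,\dots,v_n\in\mathbb S^{d-1}}\mathbb E\Big[\Big\|A(R(v_1),\dots,R(v_n))-\frac1n\sum_{i=1}^n v_i\Big\|_2^2\Big]\in[0,\infty].$$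 Additive aggregation is $A_+(z_1,\dots,z_n)=\frac1n\sum_{i=1}^n z_i$ on $(\mathbb R^d)^n$. For $p,\gamma\in[0,1]$, the randomizer $\mathrm{PrivUnit}(p,\gamma)$ on input $v\in\mathbb S^{d-1}$ draws $V$ uniformly from $\{u\in\mathbb S^{d-1}:\langle u,v\rangle\ge\gamma\}$ with probability $p$ and uniformly from $\{u\in\mathbb S^{d-1}:\langle u,v\rangle<\gamma\}$ with probability $1-p$, and returns $\frac1m V$, where, with $\alpha=\frac{d-1}2$, $\tau=\frac{1+\gamma}2$, $B(x;a,b)=\int_0^x t^{a-1}(1-t)^{b-1}\,dt$ and $B(a,b)=B(1;a,b)$, $$m=\frac{(1-\gamma^2)^{\alpha}}{2^{d-2}(d-1)}\left(\frac{p}{B(\alpha,\alpha)-B(\tau;\alpha,\alpha)}-\frac{1-p}{B(\tau;\alpha,\alpha)}\right)\quad(d\ge 2),\qquad m=2p-1\quad(d=1).$$ **Theorem.** Let $R$ be an $\varepsilon$-DP local randomizer from $\mathbb S^{d-1}$ to an arbitrary measurable space $Y$, and let $A$ be an aggregation from $Y^n$ to $\mathbb R^d$ such that $(A,R)$ is unbiased.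 Then there are $p^\star,\gamma^\star\in[0,1]$ such that $\mathrm{PrivUnit}(p^\star,\gamma^\star)$ is a well-defined ($m\ne0$) $\varepsilon$-DP local randomizer, $(A_+,\mathrm{PrivUnit}(p^\star,\gamma^\star))$ is unbiased, and $$\mathrm{err}_n(A_+,\mathrm{PrivUnit}(p^\star,\gamma^\star))\le \mathrm{err}_n(A,R).$$ -/

import Mathlib

open MeasureTheory ProbabilityTheory
open scoped ENNReal

namespace PrivateMean

/-- The Euclidean space `ℝ^d`, with the `ℓ²` norm. -/
abbrev Vec (d : ℕ) : Type := EuclideanSpace ℝ (Fin d)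

/-- The unit sphere `S^{d-1}` of `ℝ^d`. -/
abbrev USphere (d : ℕ) : Type := Metric.sphere (0 : Vec d) 1

/-- Surface measure on `S^{d-1}` (counting measure on `S^0 = {1, -1}` when `d = 1`). -/
noncomputable abbrev surf (d : ℕ) : Measure (USphere d) := (volume : Measure (Vec d)).toSphere

/-! ### Local randomizers, aggregation, error -/

/-- Two measures are `ε`-close: `e^{-ε} P(E) ≤ Q(E) ≤ e^ε P(E)` for every event `E`. -/
def AreClose {Y : Type*} [MeasurableSpace Y] (ε : ℝ) (P Q : Measure Y) : Prop :=
  ∀ E : Set Y, MeasurableSet E →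
    ENNReal.ofReal (Real.exp (-ε)) * P E ≤ Q E ∧ Q E ≤ ENNReal.ofReal (Real.exp ε) * P E

/-- `R` is an `ε`-DP local randomizer: `R v` is the law of the message sent on input `v`; it is a
probability measure for every `v`, and the laws for any two inputs are `ε`-close. -/
def IsDPLocalRandomizer {X Y : Type*} [MeasurableSpace X] [MeasurableSpace Y]
    (ε : ℝ) (R : Kernel X Y) : Prop :=
  IsMarkovKernel R ∧ ∀ x x' : X, AreClose ε (R x) (R x')

/-- The mean `(1/n) ∑ vᵢ` of the users' vectors. -/
noncomputable def meanVec {d n : ℕ} (v : Fin n → USphere d) : Vec d :=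
  (n : ℝ)⁻¹ • ∑ i, (v i : Vec d)

/-- The law of `A(R(v₁), …, R(vₙ))`, where the messages `R(vᵢ)` are drawn independently and
the aggregation `A` may itself be randomized (a deterministic aggregation `f` is
`Kernel.deterministic f _`). -/
noncomputable def outputLaw {d n : ℕ} {Y : Type*} [MeasurableSpace Y]
    (A : Kernel (Fin n → Y) (Vec d)) (R : Kernel (USphere d) Y) (v : Fin n → USphere d) :
    Measure (Vec d) :=
  (Measure.pi fun i => R (v i)).bind A

/-- `E[A(R(v₁), …, R(vₙ))]` exists and equals the mean of the `vᵢ`, for all inputs. -/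
def IsUnbiased {d n : ℕ} {Y : Type*} [MeasurableSpace Y]
    (A : Kernel (Fin n → Y) (Vec d)) (R : Kernel (USphere d) Y) : Prop :=
  ∀ v : Fin n → USphere d,
    Integrable (fun x : Vec d => x) (outputLaw A R v) ∧ ∫ x, x ∂(outputLaw A R v) = meanVec v

/-- The worst-case mean squared error `err_n(A, R)`, possibly `∞`. -/
noncomputable def err {d n : ℕ} {Y : Type*} [MeasurableSpace Y]
    (A : Kernel (Fin n → Y) (Vec d)) (R : Kernel (USphere d) Y) : ℝ≥0∞ :=
  ⨆ v : Fin n → USphere d, ∫⁻ x, ENNReal.ofReal (‖x - meanVec v‖ ^ 2) ∂(outputLaw A R v)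

/-- Additive aggregation `(z₁, …, zₙ) ↦ (1/n) ∑ zᵢ`. -/
noncomputable def additive (d n : ℕ) : Kernel (Fin n → Vec d) (Vec d) :=
  Kernel.deterministic (fun z => (n : ℝ)⁻¹ • ∑ i, z i) (by fun_prop)

/-! ### PrivUnit -/

/-- The incomplete Beta function `B(x; a, b)`; the complete one is `B(1; a, b)`. -/
noncomputable def incBeta (x a b : ℝ) : ℝ :=
  ∫ t in (0 : ℝ)..x, t ^ (a - 1) * (1 - t) ^ (b - 1)

/-- The normalization constant `m` of PrivUnit. For `d = 1` the Beta integrals diverge (`α = 0`),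
and `m` is the limit `2p - 1` of the formula as `α → 0`. -/
noncomputable def normConst (d : ℕ) (p γ : ℝ) : ℝ :=
  if d = 1 then 2 * p - 1
  else
    let α : ℝ := ((d : ℝ) - 1) / 2
    let τ : ℝ := (1 + γ) / 2
    (1 - γ ^ 2) ^ α / ((2 : ℝ) ^ ((d : ℝ) - 2) * ((d : ℝ) - 1)) *
      (p / (incBeta 1 α α - incBeta τ α α) - (1 - p) / incBeta τ α α)

/-- The cap `{u ∈ S^{d-1} : ⟨u, v⟩ ≥ γ}`. -/
def cap {d : ℕ} (γ : ℝ) (v : USphere d) : Set (USphere d) :=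
  {u | γ ≤ inner ℝ (u : Vec d) (v : Vec d)}

/-- The complementary cap `{u ∈ S^{d-1} : ⟨u, v⟩ < γ}`. -/
def coCap {d : ℕ} (γ : ℝ) (v : USphere d) : Set (USphere d) :=
  {u | inner ℝ (u : Vec d) (v : Vec d) < γ}

/-- The law of PrivUnit on input `v`: with probability `p` draw `V` uniformly from the cap, with
probability `1 - p` uniformly from its complement, and return `V / m`. -/
noncomputable def privUnitLaw {d : ℕ} (p γ : ℝ) (v : USphere d) : Measure (Vec d) :=
  (ENNReal.ofReal p • (surf d)[|cap γ v] + ENNReal.ofReal (1 - p) • (surf d)[|coCap γ v]).map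
    fun u : USphere d => (normConst d p γ)⁻¹ • (u : Vec d)

lemma measurable_cond {d : ℕ} {s : USphere d → Set (USphere d)}
    (hs : MeasurableSet {x : USphere d × USphere d | x.2 ∈ s x.1}) :
    Measurable fun v => (surf d)[|s v] := by
  refine Measure.measurable_of_measurable_coe _ fun t ht => ?_
  have h1 : Measurable fun v => surf d (s v) := measurable_measure_prodMk_left hs
  have h2 : Measurable fun v => surf d (s v ∩ t) :=
    measurable_measure_prodMk_left (hs.inter (measurable_snd ht))
  have h3 : ∀ v, MeasurableSet (s v) := fun v => measurable_prodMk_left hs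
  simp only [ProbabilityTheory.cond_apply (h3 _)]
  exact h1.inv.mul h2

lemma measurable_privUnitLaw {d : ℕ} (p γ : ℝ) :
    Measurable (privUnitLaw (d := d) p γ) := by
  have hin : Measurable fun x : USphere d × USphere d =>
      inner ℝ (x.2 : Vec d) (x.1 : Vec d) := by fun_prop
  have h1 := measurable_cond (s := cap (d := d) γ) (measurableSet_le measurable_const hin)
  have h2 := measurable_cond (s := coCap (d := d) γ) (measurableSet_lt hin measurable_const)
  have hm : Measurable fun u : USphere d => (normConst d p γ)⁻¹ • (u : Vec d) := by fun_prop
  refine Measure.measurable_of_measurable_coe _ fun t ht => ?_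
  simp only [privUnitLaw, Measure.map_apply hm ht, Measure.add_apply, Measure.smul_apply,
    smul_eq_mul]
  exact ((Measure.measurable_coe (hm ht)).comp h1 |>.const_mul _).add
    ((Measure.measurable_coe (hm ht)).comp h2 |>.const_mul _)

/-- The randomizer `PrivUnit(p, γ)`. -/
noncomputable def privUnit (d : ℕ) (p γ : ℝ) : Kernel (USphere d) (Vec d) :=
  ⟨privUnitLaw p γ, measurable_privUnitLaw p γ⟩

end PrivateMean

/-! The error of every unbiased pair and that of a tuned PrivUnit are compared with one number,
`(γ⁻² - 1) / n`.

Lower bound (`le_err_of_correlation_le`). Let the inputs `Vᵢ` be independent and uniform, with mean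
`V̄` and output `X`. Unbiasedness gives `E⟨X, V̄⟩ = E‖V̄‖² = 1/n`, so the Bayes risk is `E‖X‖² -
1/n`. Since `X` sees the inputs only through the messages, `Vᵢ` may be replaced in `E⟨X, Vᵢ⟩` by its
posterior mean `hᵢ` given the `i`-th message (`integral_inner_output_postMean`). The `hᵢ` are
independent and centered. If `‖hᵢ‖ ≤ m` almost surely, comparing `X` with a multiple of `∑ hᵢ` gives
`E‖X‖² ≥ 1 / (n m²)`. The posterior exists for arbitrary `Y` because the sphere is standard Borel.

Privacy bounds `h`. By `norm_postMean_le` it suffices to bound the correlation of `⟨v, u⟩` with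
`r(v) = R(v)(E)`, whose values differ by factors of at most `a = e^ε`. The extremal `r` is
two-valued, `a` on a cap around `u` and `1` off it. The best cap height `γ` equals the correlation
that it achieves, which is the fixed-point equation of `exists_threshold`; then `m = γ` works
(`integral_inner_mul_le`).

Upper bound. PrivUnit with that `γ`, and with `p` the mass of the cap under the extremal density, is
private, unbiased and has messages of norm `γ⁻¹` (`privUnit_capProb`), so `err_additive_le` gives
the same number. The Beta-function formula for `m` enters only in `normConst_eq`, which identifies
it with the mean of `⟨V, v⟩`. Unbiasedness forces `ε > 0` (`pos_of_isUnbiased`), hence `a > 1`. -/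

namespace PrivateMean

/-! ### The uniform distribution on the sphere -/

/-- The uniform probability measure on the sphere. -/
noncomputable def unif (d : ℕ) : Measure (USphere d) := (surf d)[|Set.univ]

lemma surf_univ_ne_zero (d : ℕ) [NeZero d] : surf d Set.univ ≠ 0 := by
  rw [Measure.measure_univ_ne_zero]
  exact Measure.toSphere_ne_zero _

instance (d : ℕ) [NeZero d] : IsProbabilityMeasure (unif d) :=
  cond_isProbabilityMeasure (surf_univ_ne_zero d)

instance (d : ℕ) [NeZero d] : Nonempty (USphere d) :=
  (NormedSpace.sphere_nonempty.2 zero_le_one).to_subtype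

lemma unif_eq_smul (d : ℕ) : unif d = (surf d Set.univ)⁻¹ • surf d := by
  simp [unif, ProbabilityTheory.cond]

/-- PrivUnit is defined by conditioning `surf`; this allows computing with the probability measure
`unif` instead. -/
lemma cond_unif {d : ℕ} [NeZero d] (s : Set (USphere d)) : (unif d)[|s] = (surf d)[|s] := by
  have h0 := surf_univ_ne_zero d
  have h1 : surf d Set.univ ≠ ∞ := measure_ne_top _ _
  rw [unif_eq_smul, ProbabilityTheory.cond, ProbabilityTheory.cond, Measure.restrict_smul,
    smul_smul, Measure.smul_apply, smul_eq_mul, ENNReal.mul_inv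
      (Or.inl (ENNReal.inv_ne_zero.2 h1)) (Or.inl (ENNReal.inv_ne_top.2 h0)),
    inv_inv, mul_right_comm, ENNReal.mul_inv_cancel h0 h1, one_mul]

lemma unif_pos_of_isOpen {d : ℕ} [NeZero d] {s : Set (USphere d)} (hs : IsOpen s)
    (hne : s.Nonempty) : 0 < unif d s := by
  rw [unif_eq_smul, Measure.smul_apply, smul_eq_mul]
  exact ENNReal.mul_pos (ENNReal.inv_ne_zero.2 (measure_ne_top _ _)) (hs.measure_pos _ hne).ne'

/-- The action of a linear isometry on the sphere. -/
noncomputable def sphereMap {d : ℕ} (e : Vec d ≃ₗᵢ[ℝ] Vec d) (u : USphere d) : USphere d :=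
  ⟨e u, by simp⟩

lemma measurable_sphereMap {d : ℕ} (e : Vec d ≃ₗᵢ[ℝ] Vec d) : Measurable (sphereMap e) :=
  (e.continuous.measurable.comp measurable_subtype_coe).subtype_mk

-- `toSphere` measures a set by the volume of the cone over it, and a linear isometry preserves
-- volume and carries cones to cones.
open scoped Pointwise in
lemma measurePreserving_surf {d : ℕ} (e : Vec d ≃ₗᵢ[ℝ] Vec d) :
    MeasurePreserving (sphereMap e) (surf d) (surf d) := by
  refine ⟨measurable_sphereMap e, Measure.ext fun s hs => ?_⟩
  have hm := measurable_sphereMap e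
  rw [Measure.map_apply hm hs, Measure.toSphere_apply' _ (hm hs), Measure.toSphere_apply' _ hs]
  congr 1
  rw [← e.measurePreserving.measure_preimage_equiv (f := e.toMeasurableEquiv)
    (Set.Ioo (0 : ℝ) 1 • (Subtype.val '' s))]
  congr 1
  ext x
  change _ ↔ e x ∈ Set.Ioo (0 : ℝ) 1 • (Subtype.val '' s)
  simp only [Set.mem_smul, Set.mem_image]
  constructor
  · rintro ⟨r, hr, -, ⟨u, hu, rfl⟩, rfl⟩
    exact ⟨r, hr, _, ⟨_, hu, rfl⟩, by simp [sphereMap]⟩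
  · rintro ⟨r, hr, -, ⟨u, hu, rfl⟩, h⟩
    refine ⟨r, hr, _, ⟨sphereMap e.symm u, ?_, rfl⟩, ?_⟩
    · simpa [sphereMap] using hu
    · apply e.injective
      simpa [sphereMap] using h

lemma measurePreserving_unif {d : ℕ} (e : Vec d ≃ₗᵢ[ℝ] Vec d) :
    MeasurePreserving (sphereMap e) (unif d) (unif d) := by
  rw [unif_eq_smul]
  exact (measurePreserving_surf e).smul_measure _

lemma integrable_of_bounded_unif {d : ℕ} [NeZero d] {F : Type*} [NormedAddCommGroup F]
    {f : USphere d → F} (hf : AEStronglyMeasurable f (unif d)) (C : ℝ) (h : ∀ u, ‖f u‖ ≤ C) :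
    Integrable f (unif d) :=
  Integrable.of_bound hf C (.of_forall h)

lemma integral_comp_sphereMap {d : ℕ} {F : Type*} [NormedAddCommGroup F] [NormedSpace ℝ F]
    (e : Vec d ≃ₗᵢ[ℝ] Vec d) (f : USphere d → F) (hf : AEStronglyMeasurable f (unif d)) :
    ∫ u, f (sphereMap e u) ∂(unif d) = ∫ u, f u ∂(unif d) := by
  have h := measurePreserving_unif e
  conv_rhs => rw [← h.map_eq]
  rw [integral_map h.measurable.aemeasurable (by rwa [h.map_eq])]

lemma exists_isometry {d : ℕ} (v w : USphere d) : ∃ e : Vec d ≃ₗᵢ[ℝ] Vec d, e v = w :=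
  ⟨_, Submodule.reflection_sub (by simp)⟩

@[fun_prop]
lemma measurable_inner_sphere {d : ℕ} (v : Vec d) :
    Measurable fun u : USphere d => inner ℝ (u : Vec d) v := by fun_prop

/-- The law of `⟨u, v⟩` under the uniform distribution does not depend on the unit vector `v`. -/
lemma map_inner_unif {d : ℕ} (v w : USphere d) :
    (unif d).map (fun u : USphere d => inner ℝ (u : Vec d) (v : Vec d)) =
      (unif d).map (fun u : USphere d => inner ℝ (u : Vec d) (w : Vec d)) := by
  obtain ⟨e, he⟩ := exists_isometry v w
  conv_rhs => rw [← (measurePreserving_unif e).map_eq]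
  rw [Measure.map_map (by fun_prop) (measurable_sphereMap e)]
  congr 1
  ext u
  simp [sphereMap, ← he]

/-- Averages weighted by a function of `⟨u, v⟩` are multiples of `v`. -/
lemma integral_inner_smul {d : ℕ} [NeZero d] (g : ℝ → ℝ) (hg : Measurable g) (C : ℝ)
    (hC : ∀ t, |g t| ≤ C) (v : USphere d) :
    ∫ u, g (inner ℝ (u : Vec d) (v : Vec d)) • (u : Vec d) ∂(unif d) =
      (∫ u, g (inner ℝ (u : Vec d) (v : Vec d)) * inner ℝ (u : Vec d) (v : Vec d) ∂(unif d)) •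
        (v : Vec d) := by
  set f : USphere d → Vec d := fun u => g (inner ℝ (u : Vec d) (v : Vec d)) • (u : Vec d)
  have hmf : Measurable f := by fun_prop
  have hf : Integrable f (unif d) :=
    integrable_of_bounded_unif hmf.aestronglyMeasurable C fun u => by
      simpa [f, norm_smul] using hC _
  set w := ∫ u, f u ∂(unif d)
  -- The reflection in the line `ℝ v` preserves both `unif` and the weight, hence fixes the average
  -- `w`; so `w` lies on that line.
  let e := (ℝ ∙ (v : Vec d)).reflection
  have hev : e (v : Vec d) = v :=
    Submodule.reflection_mem_subspace_eq_self (Submodule.mem_span_singleton_self _)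
  have h1 : e w = w := by
    have h2 : e w = ∫ u, e (f u) ∂(unif d) :=
      (e.toContinuousLinearEquiv.toContinuousLinearMap.integral_comp_comm hf).symm
    rw [h2]
    refine Eq.trans ?_ (integral_comp_sphereMap e f hmf.aestronglyMeasurable)
    congr 1
    funext u
    have h3 : inner ℝ (e (u : Vec d)) (v : Vec d) = inner ℝ (u : Vec d) (v : Vec d) := by
      conv_lhs => rw [← hev]
      exact e.inner_map_map _ _
    simp only [f, sphereMap, h3, map_smul]
  have h4 : inner ℝ (v : Vec d) w =
      ∫ u, g (inner ℝ (u : Vec d) (v : Vec d)) * inner ℝ (u : Vec d) (v : Vec d) ∂(unif d) := by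
    rw [← integral_inner hf]
    congr 1
    funext u
    simp only [f, inner_smul_right, real_inner_comm]
  rw [← h4]
  have h5 := Submodule.reflection_singleton_apply (𝕜 := ℝ) (v : Vec d) w
  have h6 : (2 : ℝ) • w = (2 : ℝ) • (inner ℝ (v : Vec d) w • (v : Vec d)) := by
    have h7 : w = 2 • (inner ℝ (v : Vec d) w • (v : Vec d)) - w := by
      conv_lhs => rw [← h1]
      simpa using h5
    rw [two_smul ℝ w, two_smul ℝ, ← two_nsmul (inner ℝ (v : Vec d) w • (v : Vec d))]
    exact eq_sub_iff_add_eq.1 h7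
  exact smul_right_injective _ (two_ne_zero' ℝ) h6

lemma integral_coe_unif (d : ℕ) : ∫ u, (u : Vec d) ∂(unif d) = 0 := by
  have h := integral_comp_sphereMap (LinearIsometryEquiv.neg ℝ) (fun u : USphere d => (u : Vec d))
    (by fun_prop)
  simp only [sphereMap, LinearIsometryEquiv.coe_neg, integral_neg] at h
  have h2 : (2 : ℝ) • ∫ u, (u : Vec d) ∂(unif d) = 0 := by
    rw [two_smul]
    nth_rw 1 [← h]
    simp
  simpa using h2

/-! ### Products of kernels -/

section PiKernel

variable {X Y : Type*} [MeasurableSpace X] [MeasurableSpace Y] {n : ℕ}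

lemma measurable_pi_kernel (K : Kernel X Y) [IsMarkovKernel K] :
    Measurable fun v : Fin n → X => Measure.pi fun i => K (v i) := by
  refine Measurable.measure_of_isPiSystem_of_isProbabilityMeasure
    generateFrom_pi.symm isPiSystem_pi ?_
  rintro _ ⟨s, hs, rfl⟩
  simp only [Measure.pi_pi]
  exact Finset.measurable_prod _ fun i _ =>
    (K.measurable_coe (hs i (Set.mem_univ i))).comp (measurable_pi_apply i)

/-- Independent samples from `K (v i)`, for `i : Fin n`. -/
noncomputable def piKernel (n : ℕ) (K : Kernel X Y) [IsMarkovKernel K] :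
    Kernel (Fin n → X) (Fin n → Y) :=
  ⟨fun v => Measure.pi fun i => K (v i), measurable_pi_kernel K⟩

lemma piKernel_apply (K : Kernel X Y) [IsMarkovKernel K] (v : Fin n → X) :
    piKernel n K v = Measure.pi fun i => K (v i) := rfl

instance (K : Kernel X Y) [IsMarkovKernel K] : IsMarkovKernel (piKernel n K) :=
  ⟨fun v => by rw [piKernel_apply]; infer_instance⟩

lemma lintegral_pi_prod (μ : Measure X) [IsProbabilityMeasure μ] (f : Fin n → X → ℝ≥0∞)
    (hf : ∀ i, Measurable (f i)) :
    ∫⁻ v, ∏ i, f i (v i) ∂(Measure.pi fun _ : Fin n => μ) = ∏ i, ∫⁻ x, f i x ∂μ := by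
  rw [lintegral_prod_eq_prod_lintegral_of_indepFun Finset.univ (fun i (v : Fin n → X) => f i (v i))
    (iIndepFun_pi (μ := fun _ : Fin n => μ) fun i => (hf i).aemeasurable)
    fun i => (hf i).comp (measurable_pi_apply i)]
  exact Finset.prod_congr rfl fun i _ =>
    (measurePreserving_eval (fun _ : Fin n => μ) i).lintegral_comp (hf i)

/-- Sampling pairs independently is the same as sampling all first components and then all
second components. -/
lemma pi_compProd (μ : Measure X) [IsProbabilityMeasure μ] (K : Kernel X Y) [IsMarkovKernel K] :
    (Measure.pi fun _ : Fin n => μ ⊗ₘ K).map (fun ω => (fun i => (ω i).1, fun i => (ω i).2)) =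
      (Measure.pi fun _ : Fin n => μ) ⊗ₘ piKernel n K := by
  have hz : Measurable fun (x : (Fin n → X) × (Fin n → Y)) (i : Fin n) => (x.1 i, x.2 i) := by
    fun_prop
  have hu : Measurable fun ω : Fin n → X × Y => (fun i => (ω i).1, fun i => (ω i).2) := by
    fun_prop
  -- A product measure is determined by boxes, on which the right-hand side factors over the
  -- coordinates.
  have key : (Measure.pi fun _ : Fin n => μ ⊗ₘ K) =
      ((Measure.pi fun _ : Fin n => μ) ⊗ₘ piKernel n K).map fun x i => (x.1 i, x.2 i) := by
    refine Measure.pi_eq fun s hs => ?_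
    rw [Measure.map_apply hz (.univ_pi hs), Measure.compProd_apply (hz (.univ_pi hs))]
    have h1 : ∀ v : Fin n → X, piKernel n K v (Prod.mk v ⁻¹'
        ((fun (x : (Fin n → X) × (Fin n → Y)) i => (x.1 i, x.2 i)) ⁻¹' Set.univ.pi s)) =
        ∏ i, K (v i) (Prod.mk (v i) ⁻¹' s i) := fun v => by
      rw [piKernel_apply, ← Measure.pi_pi]
      congr 1
    simp only [h1]
    rw [lintegral_pi_prod μ (fun i x => K x (Prod.mk x ⁻¹' s i))
      fun i => Kernel.measurable_kernel_prodMk_left (hs i)]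
    exact Finset.prod_congr rfl fun i _ => (Measure.compProd_apply (hs i)).symm
  rw [key, Measure.map_map hu hz]
  exact Measure.map_id

/-- The posterior of a product is the product of the posteriors. -/
lemma compProd_piKernel_posterior [StandardBorelSpace X] [Nonempty X]
    (μ : Measure X) [IsProbabilityMeasure μ] (K : Kernel X Y) [IsMarkovKernel K] :
    ((Measure.pi fun _ : Fin n => μ) ⊗ₘ piKernel n K).map Prod.swap =
      (Measure.pi fun _ : Fin n => K ∘ₘ μ) ⊗ₘ piKernel n (K†μ) := by
  rw [← pi_compProd, ← pi_compProd, compProd_posterior_eq_map_swap,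
    ← Measure.pi_map_pi (fun _ => measurable_swap.aemeasurable),
    Measure.map_map (by fun_prop) (by fun_prop), Measure.map_map (by fun_prop) (by fun_prop)]
  rfl

end PiKernel

/-! ### Second moments -/

section SecondMoments

variable {Ω : Type*} [MeasurableSpace Ω] {P : Measure Ω} {d : ℕ}

lemma integrable_inner_of_memLp {f g : Ω → Vec d} (hf : MemLp f 2 P) (hg : MemLp g 2 P) :
    Integrable (fun ω => inner ℝ (f ω) (g ω)) P := by
  refine (hf.norm.integrable_mul hg.norm).mono (hf.1.inner hg.1) (.of_forall fun ω => ?_)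
  simpa using norm_inner_le_norm (𝕜 := ℝ) (f ω) (g ω)

lemma integral_norm_sub_sq {f g : Ω → Vec d} (hf : MemLp f 2 P) (hg : MemLp g 2 P) :
    ∫ ω, ‖f ω - g ω‖ ^ 2 ∂P =
      ∫ ω, ‖f ω‖ ^ 2 ∂P - 2 * ∫ ω, inner ℝ (f ω) (g ω) ∂P + ∫ ω, ‖g ω‖ ^ 2 ∂P := by
  have h1 := integrable_inner_of_memLp hf hg
  have hf2 : Integrable (fun ω => ‖f ω‖ ^ 2) P := hf.norm.integrable_sq
  have hg2 : Integrable (fun ω => ‖g ω‖ ^ 2) P := hg.norm.integrable_sq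
  simp only [norm_sub_sq_real]
  have h3 : Integrable (fun ω => ‖f ω‖ ^ 2 - 2 * inner ℝ (f ω) (g ω)) P :=
    hf2.sub (h1.const_mul 2)
  rw [integral_add h3 hg2, integral_sub hf2 (h1.const_mul 2), integral_const_mul]

/-- Second moments of sums of independent centered vectors add up. -/
lemma integral_norm_sum_sq {n : ℕ} {Z : Type*} [MeasurableSpace Z] (P : Fin n → Measure Z)
    [∀ i, IsProbabilityMeasure (P i)] (f : Fin n → Z → Vec d) (hm : ∀ i, Measurable (f i))
    (hf : ∀ i, MemLp (f i) 2 (P i)) (h0 : ∀ i, ∫ z, f i z ∂(P i) = 0) :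
    ∫ ω, ‖∑ i, f i (ω i)‖ ^ 2 ∂(Measure.pi P) = ∑ i, ∫ z, ‖f i z‖ ^ 2 ∂(P i) := by
  have hL : ∀ i, MemLp (fun ω : Fin n → Z => f i (ω i)) 2 (Measure.pi P) := fun i =>
    (hf i).comp_measurePreserving (measurePreserving_eval P i)
  have hmean : ∀ i, ∫ ω, f i (ω i) ∂(Measure.pi P) = 0 := fun i => by
    rw [integral_comp_eval (hf i).1, h0 i]
  simp only [← real_inner_self_eq_norm_sq, sum_inner, inner_sum]
  rw [integral_finsetSum _ fun i _ => integrable_finsetSum _ fun j _ =>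
    integrable_inner_of_memLp (hL j) (hL i)]
  refine Finset.sum_congr rfl fun i _ => ?_
  rw [integral_finsetSum _ fun j _ => integrable_inner_of_memLp (hL j) (hL i),
    Finset.sum_eq_single i]
  · exact integral_comp_eval (μ := P) (i := i) (f := fun z => inner ℝ (f i z) (f i z))
      ((hf i).1.inner (hf i).1)
  · intro j _ hji
    have hind : IndepFun (fun ω : Fin n → Z => f j (ω j)) (fun ω => f i (ω i)) (Measure.pi P) :=
      (iIndepFun_pi (μ := P) fun k => (hm k).aemeasurable).indepFun hji
    have := hind.integral_bilin ((hL j).integrable one_le_two) ((hL i).integrable one_le_two)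
      (innerSL ℝ)
    rw [hmean, hmean, map_zero] at this
    exact this
  · simp

end SecondMoments

/-! ### Posterior means -/

section Posterior

variable {X Y : Type*} [MeasurableSpace X] [MeasurableSpace Y] {d : ℕ}

lemma norm_integral_le_one {P : Measure X} [IsProbabilityMeasure P] {φ : X → Vec d}
    (h : ∀ x, ‖φ x‖ ≤ 1) : ‖∫ x, φ x ∂P‖ ≤ 1 := by
  simpa using norm_integral_le_of_norm_le_const (μ := P) (.of_forall h)

lemma integrable_inner_of_le_one {P : Measure X} {f φ : X → Vec d} (hf : Integrable f P)
    (hφ : AEStronglyMeasurable φ P) (h : ∀ x, ‖φ x‖ ≤ 1) :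
    Integrable (fun x => inner ℝ (f x) (φ x)) P :=
  hf.norm.mono (hf.1.inner hφ) (.of_forall fun x => by
    simpa using (norm_inner_le_norm (𝕜 := ℝ) (f x) (φ x)).trans
      (mul_le_of_le_one_right (norm_nonneg _) (h x)))

/-- Against a function of `y`, a function of `x` may be replaced by its conditional mean
given `y`. -/
lemma integral_inner_condMean {J : Measure (X × Y)} {ν : Measure Y} [IsProbabilityMeasure ν]
    {η : Kernel Y X} [IsMarkovKernel η] (hJ : J.map Prod.swap = ν ⊗ₘ η)
    {φ : X → Vec d} (hφ : Measurable φ) (h1 : ∀ x, ‖φ x‖ ≤ 1)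
    {F : Y → Vec d} (hF : Measurable F) (hFJ : Integrable (fun p => F p.2) J) :
    ∫ p, inner ℝ (F p.2) (φ p.1) ∂J = ∫ p, inner ℝ (F p.2) (∫ x, φ x ∂(η p.2)) ∂J := by
  have hcm : StronglyMeasurable fun y => ∫ x, φ x ∂(η y) :=
    hφ.stronglyMeasurable.integral_kernel
  have hI : Integrable (fun q : Y × X => F q.1) (ν ⊗ₘ η) := by
    rw [← hJ]
    exact (integrable_map_measure (g := fun q : Y × X => F q.1)
      (hF.comp measurable_fst).aestronglyMeasurable measurable_swap.aemeasurable).2 hFJ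
  have hG : Integrable (fun q : Y × X => inner ℝ (F q.1) (φ q.2)) (ν ⊗ₘ η) :=
    integrable_inner_of_le_one hI (hφ.comp measurable_snd).aestronglyMeasurable fun q => h1 q.2
  have hH : Integrable (fun q : Y × X => inner ℝ (F q.1) (∫ x, φ x ∂(η q.1))) (ν ⊗ₘ η) :=
    integrable_inner_of_le_one hI (hcm.comp_measurable measurable_fst).aestronglyMeasurable
      fun q => norm_integral_le_one h1
  have hsw : ∀ G : Y × X → ℝ, AEStronglyMeasurable G (ν ⊗ₘ η) →
      ∫ p, G (p.2, p.1) ∂J = ∫ q, G q ∂(ν ⊗ₘ η) := fun G hG => by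
    rw [← hJ] at hG ⊢
    exact (integral_map measurable_swap.aemeasurable hG).symm
  refine (hsw (fun q => inner ℝ (F q.1) (φ q.2)) hG.1).trans (Eq.trans ?_
    (hsw (fun q => inner ℝ (F q.1) (∫ x, φ x ∂(η q.1))) hH.1).symm)
  rw [Measure.integral_compProd hG, Measure.integral_compProd hH]
  refine integral_congr_ae (.of_forall fun y => ?_)
  simp only [integral_const, probReal_univ, one_smul]
  exact integral_inner (Integrable.of_bound hφ.aestronglyMeasurable 1 (.of_forall h1)) _

end Posterior

variable {d n : ℕ} [NeZero d] {Y : Type*} [MeasurableSpace Y]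

omit [NeZero d] in
lemma norm_coe_sphere (u : USphere d) : ‖(u : Vec d)‖ = 1 := by simp

/-- The mean of a uniform input, given the message. -/
noncomputable def postMean (R : Kernel (USphere d) Y) [IsMarkovKernel R] (y : Y) : Vec d :=
  ∫ v, (v : Vec d) ∂((R†(unif d)) y)

section PostMean

variable (R : Kernel (USphere d) Y) [IsMarkovKernel R]

lemma measurable_postMean : Measurable (postMean R) :=
  (StronglyMeasurable.integral_kernel (κ := R†(unif d))
    measurable_subtype_coe.stronglyMeasurable).measurable

lemma norm_postMean_le_one (y : Y) : ‖postMean R y‖ ≤ 1 :=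
  norm_integral_le_one fun v => (norm_coe_sphere v).le

/-- Tower property: the posterior means average to the prior mean, which is zero. -/
lemma integral_postMean : ∫ y, postMean R y ∂(R ∘ₘ unif d) = 0 := by
  have hc : Integrable (fun q : Y × USphere d => (q.2 : Vec d))
      ((R ∘ₘ unif d) ⊗ₘ R†(unif d)) :=
    Integrable.of_bound (by fun_prop) 1 (.of_forall fun q => (norm_coe_sphere q.2).le)
  have h := Measure.integral_compProd hc
  change _ = ∫ y, postMean R y ∂(R ∘ₘ unif d) at h
  rw [← h, compProd_posterior_eq_map_swap, integral_map (by fun_prop) (by fun_prop)]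
  have h2 : Integrable (fun q : USphere d × Y => (q.1 : Vec d)) (unif d ⊗ₘ R) :=
    Integrable.of_bound (by fun_prop) 1 (.of_forall fun q => (norm_coe_sphere q.1).le)
  have h3 := Measure.integral_compProd h2
  simp only [integral_const, probReal_univ, one_smul, integral_coe_unif] at h3
  exact h3

/-- Both sides are the expectation of `⟨v, u⟩` on the event that the message lies in `E`, computed
by conditioning on the message and on the input respectively. -/
lemma setIntegral_inner_postMean {E : Set Y} (hE : MeasurableSet E) (u : Vec d) :
    ∫ y in E, inner ℝ u (postMean R y) ∂(R ∘ₘ unif d) =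
      ∫ v, inner ℝ (v : Vec d) u * (R v).real E ∂(unif d) := by
  have hJ := (compProd_posterior_eq_map_swap (μ := unif d) (κ := R)).symm
  have hm := measurable_postMean R
  have key := integral_inner_condMean hJ (φ := fun v => (v : Vec d)) measurable_subtype_coe
    (fun v => (norm_coe_sphere v).le) (F := E.indicator fun _ => u)
    (measurable_const.indicator hE)
    (Integrable.of_bound (by
      exact (measurable_const.indicator hE |>.comp measurable_snd).aestronglyMeasurable) ‖u‖
      (.of_forall fun p => norm_indicator_le_norm_self _ _))
  have hmi : Measurable (E.indicator fun _ : Y => u) := measurable_const.indicator hE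
  have hb : ∀ y, ‖E.indicator (fun _ => u) y‖ ≤ ‖u‖ := fun y => norm_indicator_le_norm_self _ _
  have hi1 : Integrable (fun p : USphere d × Y =>
      inner ℝ (E.indicator (fun _ => u) p.2) (p.1 : Vec d)) (unif d ⊗ₘ R) :=
    integrable_inner_of_le_one (Integrable.of_bound
      (hmi.comp measurable_snd).aestronglyMeasurable ‖u‖ (.of_forall fun p => hb _))
      (by fun_prop) fun p => (norm_coe_sphere p.1).le
  have hi2 : Integrable (fun p : USphere d × Y =>
      inner ℝ (E.indicator (fun _ => u) p.2) (postMean R p.2)) (unif d ⊗ₘ R) :=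
    integrable_inner_of_le_one (Integrable.of_bound
      (hmi.comp measurable_snd).aestronglyMeasurable ‖u‖ (.of_forall fun p => hb _))
      (hm.comp measurable_snd).aestronglyMeasurable fun p => norm_postMean_le_one R p.2
  have hsnd : (unif d ⊗ₘ R).map Prod.snd = R ∘ₘ unif d := Measure.snd_compProd _ _
  have e2 : ∫ p : USphere d × Y, inner ℝ (E.indicator (fun _ => u) p.2) (postMean R p.2)
      ∂(unif d ⊗ₘ R) = ∫ y in E, inner ℝ u (postMean R y) ∂(R ∘ₘ unif d) := by
    rw [← integral_indicator hE, ← hsnd, integral_map (by fun_prop)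
      (((measurable_const.inner hm).indicator hE).aestronglyMeasurable)]
    congr 1
    funext p
    by_cases hp : p.2 ∈ E <;> simp [hp]
  rw [← e2]
  refine key.symm.trans ?_
  rw [Measure.integral_compProd hi1]
  congr 1
  funext v
  have : ∀ y, inner ℝ (E.indicator (fun _ => u) y) (v : Vec d) =
      E.indicator (fun _ => inner ℝ (v : Vec d) u) y := fun y => by
    by_cases hy : y ∈ E <;> simp [hy, real_inner_comm]
  simp only [this]
  rw [integral_indicator hE, setIntegral_const, smul_eq_mul, mul_comm]

/-- If no event correlates with the input by more than `m`, posterior means have norm at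
most `m`. -/
lemma norm_postMean_le {m : ℝ} (hm0 : 0 ≤ m)
    (key : ∀ (u : USphere d) (E : Set Y), MeasurableSet E →
      ∫ v, inner ℝ (v : Vec d) (u : Vec d) * (R v).real E ∂(unif d) ≤
        m * ∫ v, (R v).real E ∂(unif d)) :
    ∀ᵐ y ∂(R ∘ₘ unif d), ‖postMean R y‖ ≤ m := by
  have hm := measurable_postMean R
  have h1 : ∀ u : USphere d, ∀ᵐ y ∂(R ∘ₘ unif d), inner ℝ (u : Vec d) (postMean R y) ≤ m := by
    intro u
    refine ae_le_of_forall_setIntegral_le (g := fun _ => m) ?_ (integrable_const _) ?_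
    · refine Integrable.of_bound (by fun_prop) 1 (.of_forall fun y => ?_)
      refine (norm_inner_le_norm (𝕜 := ℝ) _ _).trans ?_
      rw [norm_coe_sphere, one_mul]
      exact norm_postMean_le_one R y
    · intro E hE _
      rw [setIntegral_inner_postMean R hE, setIntegral_const, smul_eq_mul]
      refine (key u E hE).trans_eq ?_
      have h2 : ∫ v, (R v).real E ∂(unif d) = (R ∘ₘ unif d).real E := by
        simp only [Measure.real]
        rw [integral_toReal (R.measurable_coe hE).aemeasurable
          (.of_forall fun v => measure_lt_top _ _), Measure.bind_apply hE R.aemeasurable]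
      rw [h2, mul_comm]
  -- The null set in `h1` depends on the direction `u`; a countable dense set of directions and
  -- continuity give one null set for all of them.
  have h2 : ∀ᵐ y ∂(R ∘ₘ unif d), ∀ k,
      inner ℝ ((TopologicalSpace.denseSeq (USphere d) k : USphere d) : Vec d) (postMean R y) ≤ m :=
    ae_all_iff.2 fun k => h1 _
  filter_upwards [h2] with y hy
  have h3 : ∀ u : USphere d, inner ℝ (u : Vec d) (postMean R y) ≤ m := fun u =>
    (TopologicalSpace.denseRange_denseSeq (USphere d)).induction_on
      (p := fun u : USphere d => inner ℝ (u : Vec d) (postMean R y) ≤ m) u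
      (isClosed_le (by fun_prop) continuous_const) hy
  by_cases h0 : postMean R y = 0
  · simpa [h0] using hm0
  -- Testing in the direction of the posterior mean itself recovers its norm.
  · have h4 := h3 ⟨‖postMean R y‖⁻¹ • postMean R y, by
      simp [norm_smul, h0]⟩
    have h5 : ‖postMean R y‖ ≠ 0 := by simpa using h0
    rw [inner_smul_left, real_inner_self_eq_norm_sq] at h4
    simp only [map_inv₀, conj_trivial] at h4
    rwa [sq, inv_mul_cancel_left₀ h5] at h4

end PostMean

/-! ### The lower bound -/

section LowerBound

variable {d n : ℕ} [NeZero d] {Y : Type*} [MeasurableSpace Y]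

/-- The joint law of independent uniform inputs and their messages. -/
noncomputable def inputLaw (n : ℕ) (R : Kernel (USphere d) Y) [IsMarkovKernel R] :
    Measure ((Fin n → USphere d) × (Fin n → Y)) :=
  (Measure.pi fun _ : Fin n => unif d) ⊗ₘ piKernel n R

instance (R : Kernel (USphere d) Y) [IsMarkovKernel R] : IsProbabilityMeasure (inputLaw n R) := by
  rw [inputLaw]; infer_instance

/-- The joint law of independent uniform inputs, their messages and the output. -/
noncomputable def jointLaw (A : Kernel (Fin n → Y) (Vec d)) (R : Kernel (USphere d) Y)
    [IsMarkovKernel R] : Measure (((Fin n → USphere d) × (Fin n → Y)) × Vec d) :=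
  inputLaw n R ⊗ₘ A.comap Prod.snd measurable_snd

variable (A : Kernel (Fin n → Y) (Vec d)) [IsMarkovKernel A] (R : Kernel (USphere d) Y)
  [IsMarkovKernel R]

instance : IsProbabilityMeasure (jointLaw A R) := by
  rw [jointLaw]; infer_instance

lemma jointLaw_map_fst : (jointLaw A R).map Prod.fst = inputLaw n R :=
  Measure.fst_compProd _ _

/-- Integrating out the messages leaves, given inputs `v`, the law `outputLaw A R v` in which `err`
and unbiasedness are phrased. -/
lemma jointLaw_map_input_output :
    (jointLaw A R).map (fun q => (q.1.1, q.2)) =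
      (Measure.pi fun _ : Fin n => unif d) ⊗ₘ (A ∘ₖ piKernel n R) := by
  refine Measure.ext_of_lintegral _ fun f hf => ?_
  have hg : Measurable fun q : ((Fin n → USphere d) × (Fin n → Y)) × Vec d => f (q.1.1, q.2) := by
    fun_prop
  rw [lintegral_map hf (by fun_prop), jointLaw, inputLaw, Measure.lintegral_compProd hg,
    Measure.lintegral_compProd (Measurable.lintegral_kernel_prod_right' hg),
    Measure.lintegral_compProd hf]
  refine lintegral_congr fun v => ?_
  rw [Kernel.lintegral_comp _ _ _ (by fun_prop)]
  rfl

omit [NeZero d] [IsMarkovKernel A] in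
lemma comp_piKernel_apply (v : Fin n → USphere d) : (A ∘ₖ piKernel n R) v = outputLaw A R v :=
  Kernel.comp_apply _ _ _

@[fun_prop]
lemma measurable_meanVec {d n : ℕ} : Measurable (meanVec : (Fin n → USphere d) → Vec d) := by
  unfold meanVec
  fun_prop

/-- The Bayes risk under uniform inputs is at most the worst-case error. -/
lemma lintegral_jointLaw_le_err :
    ∫⁻ q, ENNReal.ofReal (‖q.2 - meanVec q.1.1‖ ^ 2) ∂(jointLaw A R) ≤ err A R := by
  have hf : Measurable fun r : (Fin n → USphere d) × Vec d =>
      ENNReal.ofReal (‖r.2 - meanVec r.1‖ ^ 2) := by fun_prop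
  have h := lintegral_map (μ := jointLaw A R) hf
    (g := fun q => (q.1.1, q.2)) (by fun_prop)
  rw [jointLaw_map_input_output, Measure.lintegral_compProd hf] at h
  rw [← h]
  calc _ ≤ ∫⁻ v, err A R ∂(Measure.pi fun _ : Fin n => unif d) := by
        refine lintegral_mono fun v => ?_
        rw [comp_piKernel_apply]
        exact le_iSup (fun v => ∫⁻ x, ENNReal.ofReal (‖x - meanVec v‖ ^ 2) ∂(outputLaw A R v)) v
    _ = err A R := by simp

omit [NeZero d] in
lemma norm_meanVec_le_one (v : Fin n → USphere d) : ‖meanVec v‖ ≤ 1 := by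
  rw [meanVec, norm_smul, norm_inv, RCLike.norm_natCast]
  have : ‖∑ i, (v i : Vec d)‖ ≤ n := by
    simpa using norm_sum_le_of_le Finset.univ fun i _ => (norm_coe_sphere (v i)).le
  rcases Nat.eq_zero_or_pos n with rfl | hn
  · simp
  · rw [inv_mul_le_iff₀ (by positivity), mul_one]
    exact this

lemma integral_pi_unif_norm_sum_sq :
    ∫ v, ‖∑ i, (v i : Vec d)‖ ^ 2 ∂(Measure.pi fun _ : Fin n => unif d) = n := by
  rw [integral_norm_sum_sq (fun _ : Fin n => unif d) (fun _ u => (u : Vec d))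
    (fun _ => measurable_subtype_coe)
    (fun _ => MemLp.of_bound (by fun_prop) 1 (.of_forall fun u => (norm_coe_sphere u).le))
    fun _ => integral_coe_unif d]
  simp

variable {A R}

/-- Conditionally on the inputs the output has mean `meanVec`. The lower bound uses unbiasedness
only through this identity. -/
lemma integral_inner_output_input (hA : IsUnbiased A R)
    (hX : Integrable (fun q => q.2) (jointLaw A R)) (w : (Fin n → USphere d) → Vec d)
    (hw : Measurable w) (hw1 : ∀ v, ‖w v‖ ≤ 1) :
    ∫ q, inner ℝ q.2 (w q.1.1) ∂(jointLaw A R) =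
      ∫ v, inner ℝ (meanVec v) (w v) ∂(Measure.pi fun _ : Fin n => unif d) := by
  have hm : Measurable fun q : ((Fin n → USphere d) × (Fin n → Y)) × Vec d => (q.1.1, q.2) := by
    fun_prop
  have hX' : Integrable (fun r => r.2)
      ((Measure.pi fun _ : Fin n => unif d) ⊗ₘ (A ∘ₖ piKernel n R)) := by
    rw [← jointLaw_map_input_output]
    exact (integrable_map_measure (g := fun r : (Fin n → USphere d) × Vec d => r.2)
      (by fun_prop) hm.aemeasurable).2 hX
  have hG : Integrable (fun r : (Fin n → USphere d) × Vec d => inner ℝ r.2 (w r.1))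
      ((Measure.pi fun _ : Fin n => unif d) ⊗ₘ (A ∘ₖ piKernel n R)) :=
    integrable_inner_of_le_one hX' (hw.comp measurable_fst).aestronglyMeasurable
      fun r => hw1 r.1
  have h := Measure.integral_compProd hG
  rw [← jointLaw_map_input_output] at hG h
  rw [integral_map hm.aemeasurable hG.1] at h
  refine h.trans (integral_congr_ae (.of_forall fun v => ?_))
  simp only [comp_piKernel_apply]
  rw [← (hA v).2, real_inner_comm, ← integral_inner (hA v).1]
  simp only [real_inner_comm]

/-- Given the messages, the output is independent of the inputs, so it may first be averaged to a
function of the messages. The conditional mean of the `i`-th input given all messages depends on the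
`i`-th alone, because the posterior of a product is a product. -/
lemma integral_inner_output_postMean
    (hX : Integrable (fun q => q.2) (jointLaw A R)) (i : Fin n) :
    ∫ q, inner ℝ q.2 (postMean R (q.1.2 i)) ∂(jointLaw A R) =
      ∫ q, inner ℝ q.2 (q.1.1 i : Vec d) ∂(jointLaw A R) := by
  have hpm := measurable_postMean R
  have h1 : Integrable (fun q : ((Fin n → USphere d) × (Fin n → Y)) × Vec d =>
      inner ℝ q.2 (q.1.1 i : Vec d)) (jointLaw A R) :=
    integrable_inner_of_le_one hX (Measurable.aestronglyMeasurable (by fun_prop))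
      fun q => (norm_coe_sphere _).le
  have h2 : Integrable (fun q : ((Fin n → USphere d) × (Fin n → Y)) × Vec d =>
      inner ℝ q.2 (postMean R (q.1.2 i))) (jointLaw A R) :=
    integrable_inner_of_le_one hX (hpm.comp (by fun_prop)).aestronglyMeasurable
      fun q => norm_postMean_le_one R _
  have hae : ∀ᵐ p ∂(inputLaw n R), Integrable (fun x : Vec d => x) (A p.2) :=
    (Measure.integrable_compProd_iff hX.1).1 hX |>.1
  have hF : Measurable fun y => ∫ x, x ∂(A y) :=
    (StronglyMeasurable.integral_kernel (κ := A) stronglyMeasurable_id).measurable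
  have hFJ : Integrable (fun p => ∫ x, x ∂(A p.2)) (inputLaw n R) := by
    refine ((Measure.integrable_compProd_iff hX.1).1 hX).2.mono
      (hF.comp measurable_snd).aestronglyMeasurable (.of_forall fun p => ?_)
    rw [Real.norm_of_nonneg (integral_nonneg fun _ => norm_nonneg _)]
    exact norm_integral_le_integral_norm _
  have key := integral_inner_condMean (compProd_piKernel_posterior (n := n) (unif d) R)
    (φ := fun v => (v i : Vec d)) (by fun_prop) (fun v => (norm_coe_sphere _).le) hF hFJ
  have hpost : ∀ y : Fin n → Y, ∫ v, (v i : Vec d) ∂(piKernel n (R†(unif d)) y) =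
      postMean R (y i) := fun y =>
    integral_comp_eval (μ := fun j => (R†(unif d)) (y j)) (i := i)
      (f := fun u : USphere d => (u : Vec d)) (by fun_prop)
  simp only [hpost] at key
  rw [jointLaw] at h1 h2 ⊢
  rw [Measure.integral_compProd h1, Measure.integral_compProd h2]
  refine Eq.trans ?_ (key.symm.trans ?_) <;> refine integral_congr_ae ?_
  · filter_upwards [hae] with p hp
    rw [real_inner_comm, ← integral_inner hp]
    simp only [real_inner_comm, Kernel.comap_apply]
  · filter_upwards [hae] with p hp
    rw [real_inner_comm, ← integral_inner hp]
    simp only [real_inner_comm, Kernel.comap_apply]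

/-- Under uniform inputs the messages are i.i.d. and their posterior means centered, so the cross
terms vanish. -/
lemma integral_norm_sum_postMean_sq_le {m : ℝ}
    (hle : ∀ᵐ y ∂(R ∘ₘ unif d), ‖postMean R y‖ ≤ m) :
    ∫ p, ‖∑ i, postMean R (p.2 i)‖ ^ 2 ∂(inputLaw n R) ≤ n * m ^ 2 := by
  have hpm := measurable_postMean R
  have hsnd : (inputLaw n R).map Prod.snd = Measure.pi fun _ : Fin n => R ∘ₘ unif d := by
    have h := congrArg Measure.fst (compProd_piKernel_posterior (n := n) (unif d) R)
    rw [Measure.fst_compProd] at h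
    rw [← h, Measure.fst, Measure.map_map measurable_fst measurable_swap]
    rfl
  have hmem : MemLp (postMean R) 2 (R ∘ₘ unif d) :=
    MemLp.of_bound hpm.aestronglyMeasurable 1 (.of_forall (norm_postMean_le_one R))
  have h1 := integral_norm_sum_sq (fun _ : Fin n => R ∘ₘ unif d) (fun _ => postMean R)
    (fun _ => hpm) (fun _ => hmem) fun _ => integral_postMean R
  have h2 : ∫ p, ‖∑ i, postMean R (p.2 i)‖ ^ 2 ∂(inputLaw n R) =
      ∫ y, ‖∑ i, postMean R (y i)‖ ^ 2 ∂(Measure.pi fun _ : Fin n => R ∘ₘ unif d) := by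
    rw [← hsnd, integral_map measurable_snd.aemeasurable
      (Measurable.aestronglyMeasurable (by fun_prop))]
  have h3 : ∫ y, ‖postMean R y‖ ^ 2 ∂(R ∘ₘ unif d) ≤ m ^ 2 := by
    have h4 := integral_mono_ae hmem.norm.integrable_sq (integrable_const (m ^ 2))
      (by filter_upwards [hle] with y hy using pow_le_pow_left₀ (norm_nonneg _) hy 2)
    simpa using h4
  rw [h2, h1]
  simpa using mul_le_mul_of_nonneg_left h3 (Nat.cast_nonneg (α := ℝ) n)

/-- If no event correlates with the input by more than `m`, an unbiased estimator has error at
least `(m⁻² - 1) / n`. -/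
theorem le_err_of_correlation_le (hn : n ≠ 0) (hA : IsUnbiased A R) {m : ℝ} (hm : 0 < m)
    (key : ∀ (u : USphere d) (E : Set Y), MeasurableSet E →
      ∫ v, inner ℝ (v : Vec d) (u : Vec d) * (R v).real E ∂(unif d) ≤
        m * ∫ v, (R v).real E ∂(unif d)) :
    ENNReal.ofReal ((m⁻¹ ^ 2 - 1) / n) ≤ err A R := by
  refine le_trans ?_ (lintegral_jointLaw_le_err A R)
  have hpm := measurable_postMean R
  set Q := jointLaw A R
  let W : ((Fin n → USphere d) × (Fin n → Y)) × Vec d → Vec d := fun q => q.2 - meanVec q.1.1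
  have hW : Measurable W := by fun_prop
  -- An infinite Bayes risk leaves nothing to prove; otherwise the output is square integrable.
  by_cases htop : ∫⁻ q, ENNReal.ofReal (‖W q‖ ^ 2) ∂Q = ∞
  · exact le_top.trans_eq htop.symm
  have hWi : Integrable (fun q => ‖W q‖ ^ 2) Q := by
    refine ⟨(by fun_prop), ?_⟩
    rw [hasFiniteIntegral_iff_ofReal (.of_forall fun q => by positivity)]
    exact lt_top_iff_ne_top.2 htop
  rw [← ofReal_integral_eq_lintegral_ofReal hWi (.of_forall fun q => by positivity)]
  refine ENNReal.ofReal_le_ofReal ?_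
  have hW2 : MemLp W 2 Q := (memLp_two_iff_integrable_sq_norm hW.aestronglyMeasurable).2 hWi
  have hV2 : MemLp (fun q : ((Fin n → USphere d) × (Fin n → Y)) × Vec d => meanVec q.1.1) 2 Q :=
    MemLp.of_bound (Measurable.aestronglyMeasurable (by fun_prop)) 1
      (.of_forall fun q => norm_meanVec_le_one _)
  have hX2 : MemLp (fun q : ((Fin n → USphere d) × (Fin n → Y)) × Vec d => q.2) 2 Q := by
    convert hW2.add hV2 using 1
    funext q
    simp [W]
  have hX := hX2.integrable one_le_two
  have hn' : (n : ℝ) ≠ 0 := Nat.cast_ne_zero.2 hn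
  have hVsq : ∫ v, ‖meanVec v‖ ^ 2 ∂(Measure.pi fun _ : Fin n => unif d) = 1 / n := by
    simp only [meanVec, norm_smul, mul_pow]
    rw [integral_const_mul, integral_pi_unif_norm_sum_sq]
    simp
    field_simp
  have hXV : ∫ q, inner ℝ q.2 (meanVec q.1.1) ∂Q = 1 / n := by
    rw [integral_inner_output_input hA hX _ measurable_meanVec norm_meanVec_le_one, ← hVsq]
    simp only [real_inner_self_eq_norm_sq]
  have hfst : ∀ f : (Fin n → USphere d) × (Fin n → Y) → ℝ, Measurable f →
      ∫ q, f q.1 ∂Q = ∫ p, f p ∂(inputLaw n R) := fun f hf => by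
    rw [← jointLaw_map_fst A R, integral_map measurable_fst.aemeasurable hf.aestronglyMeasurable]
  have hVQ : ∫ q, ‖meanVec q.1.1‖ ^ 2 ∂Q = 1 / n := by
    rw [hfst (fun p => ‖meanVec p.1‖ ^ 2) (by fun_prop), ← hVsq]
    have h := Measure.fst_compProd (Measure.pi fun _ : Fin n => unif d) (piKernel n R)
    conv_rhs => rw [← h]
    rw [Measure.fst, integral_map measurable_fst.aemeasurable
      (Measurable.aestronglyMeasurable (by fun_prop))]
    rfl
  -- This scaling makes `E⟨X, T⟩ = c` and `E‖T‖² ≤ c`, so `0 ≤ E‖X - T‖²` reads `E‖X‖² ≥ c`.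
  let c : ℝ := (n * m ^ 2)⁻¹
  let T : ((Fin n → USphere d) × (Fin n → Y)) × Vec d → Vec d :=
    fun q => c • ∑ i, postMean R (q.1.2 i)
  have hh2 : ∀ i : Fin n, MemLp (fun q : ((Fin n → USphere d) × (Fin n → Y)) × Vec d =>
      postMean R (q.1.2 i)) 2 Q := fun i =>
    MemLp.of_bound (Measurable.aestronglyMeasurable (by fun_prop)) 1
      (.of_forall fun q => norm_postMean_le_one R _)
  have hT2 : MemLp T 2 Q := (memLp_finsetSum _ fun i _ => hh2 i).const_smul c
  have hXT : ∫ q, inner ℝ q.2 (T q) ∂Q = c := by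
    simp only [T, inner_smul_right, inner_sum]
    rw [integral_const_mul, integral_finsetSum _ fun i _ => integrable_inner_of_memLp hX2 (hh2 i)]
    have h1 : ∀ i : Fin n, MemLp (fun q : ((Fin n → USphere d) × (Fin n → Y)) × Vec d =>
        (q.1.1 i : Vec d)) 2 Q := fun i =>
      MemLp.of_bound (Measurable.aestronglyMeasurable (by fun_prop)) 1
        (.of_forall fun q => (norm_coe_sphere _).le)
    rw [Finset.sum_congr rfl fun i _ => integral_inner_output_postMean hX i,
      ← integral_finsetSum _ fun i _ => integrable_inner_of_memLp hX2 (h1 i)]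
    have h2 : ∫ q, inner ℝ q.2 (meanVec q.1.1) ∂Q =
        (n : ℝ)⁻¹ * ∫ q, ∑ i, inner ℝ q.2 (q.1.1 i : Vec d) ∂Q := by
      simp only [meanVec, inner_smul_right, inner_sum]
      rw [integral_const_mul]
    rw [hXV, one_div] at h2
    have h3 := mul_left_cancel₀ (inv_ne_zero hn') ((mul_one _).trans h2)
    rw [← h3, mul_one]
  have hTT : ∫ q, ‖T q‖ ^ 2 ∂Q ≤ c := by
    have h1 := integral_norm_sum_postMean_sq_le (n := n) (norm_postMean_le R hm.le key)
    rw [← hfst (fun p => ‖∑ i, postMean R (p.2 i)‖ ^ 2) (by fun_prop)] at h1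
    simp only [T, norm_smul, mul_pow]
    rw [integral_const_mul]
    refine (mul_le_mul_of_nonneg_left h1 (by positivity)).trans_eq ?_
    simp only [c, Real.norm_eq_abs, sq_abs]
    field_simp
  have e1 := integral_norm_sub_sq hX2 hV2
  have e2 := integral_norm_sub_sq hX2 hT2
  have e3 : 0 ≤ ∫ q, ‖q.2 - T q‖ ^ 2 ∂Q := integral_nonneg fun q => by positivity
  have e4 : (m⁻¹ ^ 2 - 1) / n = c - 1 / n := by
    simp only [c]
    field_simp
  rw [hXV, hVQ] at e1
  rw [hXT] at e2
  change _ ≤ ∫ q, ‖q.2 - meanVec q.1.1‖ ^ 2 ∂Q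
  rw [e1, e4]
  linarith

end LowerBound

/-! ### The law of a coordinate of a uniform point of the sphere -/

/-- The radial integral in polar coordinates. -/
lemma lintegral_comp_norm (k : ℕ) (f : ℝ → ℝ≥0∞) (hf : Measurable f) :
    ∫⁻ y : Vec (k + 1), f ‖y‖ = surf (k + 1) Set.univ *
      ∫⁻ ρ in Set.Ioi (0 : ℝ), ENNReal.ofReal (ρ ^ k) * f ρ := by
  have hfin : Module.finrank ℝ (Vec (k + 1)) - 1 = k := by simp
  calc ∫⁻ y : Vec (k + 1), f ‖y‖
      = ∫⁻ y : ({(0 : Vec (k + 1))}ᶜ : Set (Vec (k + 1))), f ‖y.1‖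
          ∂((volume : Measure (Vec (k + 1))).comap (↑)) := by
        rw [lintegral_subtype_comap (measurableSet_singleton _).compl fun x : Vec (k + 1) => f ‖x‖,
          restrict_compl_singleton]
    _ = ∫⁻ x, f x.2 ∂((surf (k + 1)).prod
          (Measure.volumeIoiPow (Module.finrank ℝ (Vec (k + 1)) - 1))) := by
        simpa using (volume : Measure (Vec (k + 1))).measurePreserving_homeomorphUnitSphereProd
          |>.lintegral_comp_emb (Homeomorph.measurableEmbedding _) fun x => f x.2
    _ = surf (k + 1) Set.univ * ∫⁻ x : Set.Ioi (0 : ℝ), f x ∂(Measure.volumeIoiPow k) := by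
        rw [hfin, lintegral_prod _ (by fun_prop)]
        dsimp only
        rw [lintegral_const, mul_comm]
    _ = _ := by
        congr 1
        rw [Measure.volumeIoiPow, lintegral_withDensity_eq_lintegral_mul _ (by fun_prop)
          (by fun_prop)]
        exact lintegral_subtype_comap measurableSet_Ioi fun ρ : ℝ => ENNReal.ofReal (ρ ^ k) * f ρ

/-- The last coordinates of a vector. -/
noncomputable def tailVec {k : ℕ} (x : Vec (k + 1)) : Vec k := WithLp.toLp 2 fun i => x i.succ

lemma norm_sq_eq_head_tail {k : ℕ} (x : Vec (k + 1)) : ‖x‖ ^ 2 = x 0 ^ 2 + ‖tailVec x‖ ^ 2 := by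
  simp [EuclideanSpace.norm_sq_eq, tailVec, Fin.sum_univ_succ]

lemma measurePreserving_head_tail (k : ℕ) :
    MeasurePreserving (fun x : Vec (k + 1) => (x 0, tailVec x)) volume volume := by
  have h1 := PiLp.volume_preserving_ofLp (Fin (k + 1))
  have h2 := volume_preserving_piFinSuccAbove (fun _ : Fin (k + 1) => ℝ) 0
  have h3 := (MeasurePreserving.id (volume : Measure ℝ)).prod
    (PiLp.volume_preserving_toLp (Fin k))
  exact h3.comp (h2.comp h1)

/-- Cylindrical coordinates: polar coordinates in the `k + 1` tail variables contribute the weight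
`ρ ^ k`. -/
lemma lintegral_head_norm_tail (k : ℕ) (G : ℝ × ℝ → ℝ≥0∞) (hG : Measurable G) :
    ∫⁻ x : Vec (k + 2), G (x 0, ‖tailVec x‖) = surf (k + 1) Set.univ *
      ∫⁻ p : ℝ × ℝ, (Set.Ioi 0).indicator (fun ρ => ENNReal.ofReal (ρ ^ k)) p.2 * G p := by
  have hi : Measurable ((Set.Ioi (0 : ℝ)).indicator fun ρ => ENNReal.ofReal (ρ ^ k)) :=
    Measurable.indicator (by fun_prop) measurableSet_Ioi
  have h1 := (measurePreserving_head_tail (k + 1)).lintegral_comp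
    (f := fun q : ℝ × Vec (k + 1) => G (q.1, ‖q.2‖)) (by fun_prop)
  rw [h1, Measure.volume_eq_prod, lintegral_prod _ (by fun_prop), Measure.volume_eq_prod,
    lintegral_prod _ (by fun_prop), ← lintegral_const_mul _ (by fun_prop)]
  refine lintegral_congr fun s => ?_
  rw [lintegral_comp_norm k (fun ρ => G (s, ρ)) (by fun_prop),
    ← lintegral_indicator measurableSet_Ioi]
  congr 2
  funext ρ
  by_cases hρ : ρ ∈ Set.Ioi (0 : ℝ) <;> simp [hρ]

lemma image_cos_Ioo : Real.cos '' Set.Ioo 0 Real.pi = Set.Ioo (-1) 1 := by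
  ext t
  constructor
  · rintro ⟨θ, ⟨h0, h1⟩, rfl⟩
    constructor
    · rw [← Real.cos_pi]
      exact Real.strictAntiOn_cos ⟨h0.le, h1.le⟩ ⟨Real.pi_pos.le, le_rfl⟩ h1
    · rw [← Real.cos_zero]
      exact Real.strictAntiOn_cos ⟨le_rfl, Real.pi_pos.le⟩ ⟨h0.le, h1.le⟩ h0
  · rintro ⟨h0, h1⟩
    exact ⟨Real.arccos t, ⟨Real.arccos_pos.2 h1, Real.arccos_lt_pi.2 h0⟩,
      Real.cos_arccos h0.le h1.le⟩

/-- Substitution `t = cos θ`; the Jacobian `sin θ` absorbs one of the `k` powers. -/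
lemma lintegral_sin_pow_comp_cos (k : ℕ) (f : ℝ → ℝ≥0∞) :
    ∫⁻ θ in Set.Ioo 0 Real.pi, ENNReal.ofReal (Real.sin θ ^ k) * f (Real.cos θ) =
      ∫⁻ t in Set.Ioo (-1 : ℝ) 1, ENNReal.ofReal ((1 - t ^ 2) ^ (((k : ℝ) - 1) / 2)) * f t := by
  rw [← image_cos_Ioo, lintegral_image_eq_lintegral_abs_deriv_mul measurableSet_Ioo
    (fun θ _ => (Real.hasDerivAt_cos θ).hasDerivWithinAt)
    (Real.injOn_cos.mono Set.Ioo_subset_Icc_self)]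
  refine setLIntegral_congr_fun measurableSet_Ioo fun θ hθ => ?_
  have hs : 0 < Real.sin θ := Real.sin_pos_of_mem_Ioo hθ
  simp only [abs_neg, abs_of_pos hs]
  rw [← mul_assoc, ← ENNReal.ofReal_mul hs.le]
  congr 2
  have h1 : 1 - Real.cos θ ^ 2 = Real.sin θ ^ (2 : ℝ) := by
    rw [Real.rpow_two]
    linarith [Real.sin_sq_add_cos_sq θ]
  rw [h1, ← Real.rpow_mul hs.le, ← Real.rpow_natCast]
  nth_rw 2 [← Real.rpow_one (Real.sin θ)]
  rw [← Real.rpow_add hs]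
  congr 1
  ring

/-- A point of the half plane in the cone over `B`, of norm less than `1`. -/
def coneSet (B : Set ℝ) : Set (ℝ × ℝ) :=
  {p | 0 < √(p.1 ^ 2 + p.2 ^ 2) ∧ √(p.1 ^ 2 + p.2 ^ 2) < 1 ∧ p.1 / √(p.1 ^ 2 + p.2 ^ 2) ∈ B}

lemma measurableSet_coneSet {B : Set ℝ} (hB : MeasurableSet B) : MeasurableSet (coneSet B) := by
  have h1 : Measurable fun p : ℝ × ℝ => √(p.1 ^ 2 + p.2 ^ 2) := by fun_prop
  have h2 : Measurable fun p : ℝ × ℝ => p.1 / √(p.1 ^ 2 + p.2 ^ 2) := by fun_prop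
  exact (measurableSet_lt measurable_const h1).inter
    ((measurableSet_lt h1 measurable_const).inter (h2 hB))

-- Makes the cone whose volume defines `toSphere` a condition on the two numbers `x 0` and `‖tailVec
-- x‖`, reducing the computation to the plane.
open scoped Pointwise in
lemma Ioo_smul_eq_preimage_coneSet (k : ℕ) (B : Set ℝ) :
    (Set.Ioo (0 : ℝ) 1 • (Subtype.val '' {u : USphere (k + 1) | (u : Vec (k + 1)) 0 ∈ B}) :
      Set (Vec (k + 1))) = {x | (x 0, ‖tailVec x‖) ∈ coneSet B} := by
  have hn : ∀ x : Vec (k + 1), √(x 0 ^ 2 + ‖tailVec x‖ ^ 2) = ‖x‖ := fun x => by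
    rw [← norm_sq_eq_head_tail, Real.sqrt_sq (norm_nonneg _)]
  ext x
  simp only [Set.mem_smul, Set.mem_image, coneSet, Set.mem_ofPred_eq, hn]
  constructor
  · rintro ⟨r, ⟨h0, h1⟩, -, ⟨u, hu, rfl⟩, rfl⟩
    have : ‖r • (u : Vec (k + 1))‖ = r := by
      rw [norm_smul, norm_coe_sphere, mul_one, Real.norm_of_nonneg h0.le]
    rw [this]
    refine ⟨h0, h1, ?_⟩
    simpa [h0.ne'] using hu
  · rintro ⟨h0, h1, h2⟩
    refine ⟨‖x‖, ⟨h0, h1⟩, ‖x‖⁻¹ • x, ⟨⟨‖x‖⁻¹ • x, by simp [norm_smul, h0.ne']⟩, ?_, rfl⟩, ?_⟩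
    · simpa [div_eq_inv_mul] using h2
    · rw [smul_smul, mul_inv_cancel₀ h0.ne', one_smul]

/-- In plane polar coordinates `ρ ^ k` becomes `r ^ k * sin θ ^ k`, the Jacobian adds one factor
`r`, and the cone condition separates into `r < 1` and `cos θ ∈ B`. -/
lemma lintegral_polar_coneSet (k : ℕ) (B : Set ℝ) (hB : MeasurableSet B) :
    ∫⁻ p : ℝ × ℝ, (Set.Ioi 0).indicator (fun ρ => ENNReal.ofReal (ρ ^ k)) p.2 *
        (coneSet B).indicator 1 p =
      (∫⁻ r in Set.Ioo (0 : ℝ) 1, ENNReal.ofReal (r ^ (k + 1))) *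
        ∫⁻ θ in Set.Ioo 0 Real.pi, ENNReal.ofReal (Real.sin θ ^ k) *
          B.indicator 1 (Real.cos θ) := by
  have hmB : Measurable (B.indicator (1 : ℝ → ℝ≥0∞)) := measurable_one.indicator hB
  rw [← lintegral_indicator measurableSet_Ioo, ← lintegral_indicator measurableSet_Ioo,
    ← lintegral_prod_mul (Measurable.indicator (by fun_prop) measurableSet_Ioo).aemeasurable
      (Measurable.indicator (by fun_prop) measurableSet_Ioo).aemeasurable,
    ← lintegral_comp_polarCoord_symm, ← Measure.volume_eq_prod,
    ← lintegral_indicator polarCoord.open_target.measurableSet]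
  refine lintegral_congr fun p => ?_
  obtain ⟨r, θ⟩ := p
  by_cases hp : (r, θ) ∈ polarCoord.target
  · rw [Set.indicator_of_mem hp]
    rw [polarCoord_target] at hp
    obtain ⟨hr, hθ⟩ := hp
    simp only [Set.mem_Ioi, Set.mem_Ioo] at hr hθ
    have hs : √((r * Real.cos θ) ^ 2 + (r * Real.sin θ) ^ 2) = r := by
      rw [show (r * Real.cos θ) ^ 2 + (r * Real.sin θ) ^ 2 = r ^ 2 by
        nlinarith [Real.sin_sq_add_cos_sq θ], Real.sqrt_sq hr.le]
    have hmem : (r * Real.cos θ, r * Real.sin θ) ∈ coneSet B ↔ r < 1 ∧ Real.cos θ ∈ B := by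
      simp only [coneSet, Set.mem_ofPred_eq, hs, mul_div_cancel_left₀ _ hr.ne', hr, true_and]
    -- The polar angle ranges over `(-π, π)`; positivity of the second coordinate keeps the upper
    -- half.
    have hsin : 0 < r * Real.sin θ ↔ 0 < θ := by
      rw [mul_pos_iff_of_pos_left hr]
      constructor
      · intro h
        by_contra h0
        exact absurd (Real.sin_nonpos_of_nonpos_of_neg_pi_le (not_lt.1 h0) hθ.1.le) (not_le.2 h)
      · exact fun h => Real.sin_pos_of_pos_of_lt_pi h hθ.2
    simp only [polarCoord_symm_apply, smul_eq_mul]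
    by_cases h1 : r < 1
    · by_cases h2 : 0 < θ
      · have hsθ := Real.sin_pos_of_pos_of_lt_pi h2 hθ.2
        by_cases h3 : Real.cos θ ∈ B
        · simp only [Set.indicator, hmem, Set.mem_Ioi, hsin, Set.mem_Ioo, hr, h1, h2, h3, hθ.2,
            and_self, if_true, Pi.one_apply, mul_one]
          rw [← ENNReal.ofReal_mul hr.le, ← ENNReal.ofReal_mul (by positivity)]
          congr 1
          ring
        · simp [Set.indicator, hmem, h3]
      · simp [Set.indicator, hsin, h2]
    · simp [Set.indicator, hmem, h1]
  · rw [Set.indicator_of_notMem hp]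
    simp only [polarCoord_target, Set.mem_prod, Set.mem_Ioi, Set.mem_Ioo, not_and_or] at hp
    by_cases h1 : 0 < r
    · have h2 : θ ∉ Set.Ioo 0 Real.pi := by
        intro h
        simp only [h1, not_true, false_or] at hp
        rcases hp with hp | hp
        · exact hp (by linarith [h.1, Real.pi_pos])
        · exact hp h.2
      simp [h2]
    · simp [Set.indicator, h1]

/-- The first coordinate of a uniform point of `S^{k+1}` has a density proportional to
`(1 - t²) ^ ((k - 1) / 2)`. -/
lemma surf_map_head (k : ℕ) : ∃ C : ℝ≥0∞, ∀ B : Set ℝ, MeasurableSet B →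
    surf (k + 2) {u | (u : Vec (k + 2)) 0 ∈ B} =
      C * ∫⁻ t in Set.Ioo (-1 : ℝ) 1,
        ENNReal.ofReal ((1 - t ^ 2) ^ (((k : ℝ) - 1) / 2)) * B.indicator 1 t := by
  -- The dimension factor of `toSphere`, the area of the sphere of tail directions, and the radial
  -- integral.
  refine ⟨(k + 2 : ℕ) * (surf (k + 1) Set.univ *
    ∫⁻ r in Set.Ioo (0 : ℝ) 1, ENNReal.ofReal (r ^ (k + 1))), fun B hB => ?_⟩
  have hm : MeasurableSet {u : USphere (k + 2) | (u : Vec (k + 2)) 0 ∈ B} :=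
    hB.preimage (f := fun u : USphere (k + 2) => (u : Vec (k + 2)) 0) (by fun_prop)
  have hc := measurableSet_coneSet hB
  have ht : Measurable fun x : Vec (k + 2) => (x 0, ‖tailVec x‖) := by
    unfold tailVec
    fun_prop
  rw [Measure.toSphere_apply' _ hm, Ioo_smul_eq_preimage_coneSet, finrank_euclideanSpace,
    Fintype.card_fin, mul_assoc, mul_assoc, ← lintegral_sin_pow_comp_cos,
    ← lintegral_polar_coneSet k B hB,
    ← lintegral_head_norm_tail k _ (measurable_one.indicator hc)]
  congr 1
  exact (lintegral_indicator_one (hc.preimage ht)).symm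

/-! ### The normalization constant -/

/-- The unnormalized density of a coordinate of a uniform point of `S^{k+1}`. -/
noncomputable def coordDensity (k : ℕ) (t : ℝ) : ℝ := (1 - t ^ 2) ^ (((k : ℝ) - 1) / 2)

lemma coordDensity_nonneg {k : ℕ} {t : ℝ} (ht : t ∈ Set.Ioo (-1 : ℝ) 1) :
    0 ≤ coordDensity k t :=
  Real.rpow_nonneg (by nlinarith [ht.1, ht.2]) _

@[fun_prop]
lemma measurable_coordDensity (k : ℕ) : Measurable (coordDensity k) := by
  unfold coordDensity
  fun_prop

/-- The law of a coordinate, in terms of Bochner integrals. -/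
lemma exists_integral_comp_inner (k : ℕ) : ∃ c : ℝ, 0 < c ∧
    IntegrableOn (coordDensity k) (Set.Ioo (-1) 1) ∧
    ∀ (v : USphere (k + 2)) (g : ℝ → ℝ), Measurable g →
      ∫ u, g (inner ℝ (u : Vec (k + 2)) (v : Vec (k + 2))) ∂(unif (k + 2)) =
        c * ∫ t in Set.Ioo (-1 : ℝ) 1, coordDensity k t * g t := by
  obtain ⟨C, hC⟩ := surf_map_head k
  set ν : Measure ℝ := (volume.restrict (Set.Ioo (-1 : ℝ) 1)).withDensity fun t =>
    ENNReal.ofReal (coordDensity k t) with hν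
  have hmap : (surf (k + 2)).map (fun u : USphere (k + 2) => (u : Vec (k + 2)) 0) = C • ν := by
    refine Measure.ext fun B hB => ?_
    rw [Measure.map_apply (by fun_prop) hB, Measure.smul_apply, hν, withDensity_apply _ hB,
      smul_eq_mul, ← lintegral_indicator hB]
    refine (hC B hB).trans ?_
    congr 2
    funext t
    by_cases ht : t ∈ B <;> simp [ht, coordDensity]
  have huniv : surf (k + 2) Set.univ = C * ν Set.univ := by
    have h := congrArg (fun μ => μ Set.univ) hmap
    simpa [Measure.map_apply (show Measurable fun u : USphere (k + 2) => (u : Vec (k + 2)) 0 by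
      fun_prop) MeasurableSet.univ, -Measure.toSphere_apply_univ] using h
  have h0 := surf_univ_ne_zero (k + 2)
  have h1 : surf (k + 2) Set.univ ≠ ∞ := measure_ne_top _ _
  rw [huniv] at h0 h1
  -- The sphere has finite nonzero area, so both factors of `C * ν univ` are finite and nonzero.
  -- This yields integrability of the density without a direct estimate, even for `k = 0`, where it
  -- blows up at `±1`.
  have hC0 : C ≠ 0 := left_ne_zero_of_mul h0
  have hν0 : ν Set.univ ≠ 0 := right_ne_zero_of_mul h0
  have hCt : C ≠ ∞ := fun h => h1 (by rw [h, ENNReal.top_mul hν0])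
  have hνt : ν Set.univ ≠ ∞ := fun h => h1 (by rw [h, ENNReal.mul_top hC0])
  have hae : ∀ᵐ t ∂(volume.restrict (Set.Ioo (-1 : ℝ) 1)), 0 ≤ coordDensity k t := by
    filter_upwards [ae_restrict_mem measurableSet_Ioo] with t ht using coordDensity_nonneg ht
  refine ⟨((surf (k + 2) Set.univ)⁻¹ * C).toReal, ?_, ?_, ?_⟩
  · refine ENNReal.toReal_pos (mul_ne_zero ?_ hC0) (ENNReal.mul_ne_top ?_ hCt)
    · exact ENNReal.inv_ne_zero.2 (measure_ne_top _ _)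
    · exact ENNReal.inv_ne_top.2 (surf_univ_ne_zero _)
  · refine ⟨by fun_prop, ?_⟩
    rw [hasFiniteIntegral_iff_ofReal hae]
    rw [hν, withDensity_apply _ MeasurableSet.univ, Measure.restrict_univ] at hνt
    exact lt_top_iff_ne_top.2 hνt
  · intro v g hg
    let e : USphere (k + 2) := ⟨EuclideanSpace.single 0 1, by simp⟩
    have hve : (unif (k + 2)).map
        (fun u : USphere (k + 2) => inner ℝ (u : Vec (k + 2)) (v : Vec (k + 2))) =
        ((surf (k + 2) Set.univ)⁻¹ * C) • ν := by
      rw [map_inner_unif v e, mul_smul, ← hmap, unif_eq_smul, Measure.map_smul]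
      congr 2
      funext u
      simp [e, EuclideanSpace.inner_single_right]
    have h2 := integral_map (μ := unif (k + 2))
      (φ := fun u : USphere (k + 2) => inner ℝ (u : Vec (k + 2)) (v : Vec (k + 2))) (f := g)
      (Measurable.aemeasurable (by fun_prop)) hg.aestronglyMeasurable
    rw [← h2, hve, integral_smul_measure, smul_eq_mul, hν,
      integral_withDensity_eq_integral_toReal_smul (by fun_prop)
        (.of_forall fun _ => ENNReal.ofReal_lt_top)]
    congr 1
    refine integral_congr_ae ?_
    filter_upwards [hae] with t ht
    rw [ENNReal.toReal_ofReal ht, smul_eq_mul]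

lemma intervalIntegrable_coordDensity {k : ℕ}
    (h : IntegrableOn (coordDensity k) (Set.Ioo (-1) 1)) {a b : ℝ} (ha : -1 ≤ a) (hab : a ≤ b)
    (hb : b ≤ 1) : IntervalIntegrable (coordDensity k) volume a b := by
  rw [intervalIntegrable_iff_integrableOn_Ioo_of_le hab]
  exact h.mono_set (Set.Ioo_subset_Ioo ha hb)

/-- The antiderivative is `-(1 - t²) ^ ((k + 1) / 2) / (k + 1)`. It need only be continuous at `1`,
where the integrand is singular for `k = 0`. -/
lemma integral_coordDensity_mul_id {k : ℕ}
    (h : IntegrableOn (coordDensity k) (Set.Ioo (-1) 1)) {γ : ℝ} (h0 : -1 < γ) (h1 : γ < 1) :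
    ∫ t in γ..1, coordDensity k t * t = (1 - γ ^ 2) ^ (((k : ℝ) + 1) / 2) / (k + 1) := by
  have hk : (0 : ℝ) < (k : ℝ) + 1 := by positivity
  have hint : IntervalIntegrable (fun t => coordDensity k t * t) volume γ 1 :=
    (intervalIntegrable_coordDensity h h0.le h1.le le_rfl).mul_continuousOn continuousOn_id
  have hder : ∀ t ∈ Set.Ioo γ 1, HasDerivAt
      (fun t : ℝ => -((1 - t ^ 2) ^ (((k : ℝ) + 1) / 2) / (k + 1))) (coordDensity k t * t) t := by
    intro t ht
    have hpos : 0 < 1 - t ^ 2 := by nlinarith [ht.1, ht.2]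
    have hd : HasDerivAt (fun t : ℝ => 1 - t ^ 2) (-(2 * t)) t := by
      simpa using (hasDerivAt_pow 2 t).const_sub 1
    have := ((hd.rpow_const (p := ((k : ℝ) + 1) / 2) (Or.inl hpos.ne')).div_const
      ((k : ℝ) + 1)).neg
    refine HasDerivAt.congr_deriv this ?_
    rw [coordDensity, show ((k : ℝ) + 1) / 2 - 1 = ((k : ℝ) - 1) / 2 by ring]
    field_simp
  rw [intervalIntegral.integral_eq_sub_of_hasDerivAt_of_le h1.le ?_ hder hint]
  · rw [one_pow, sub_self, Real.zero_rpow (by positivity)]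
    ring
  · refine ContinuousOn.neg (ContinuousOn.div_const (ContinuousOn.rpow_const (by fun_prop) ?_) _)
    exact fun t _ => Or.inr (by positivity)

/-- Substitution `t = 2 s - 1`: then `1 - t² = 4 s (1 - s)`, and the constants combine to `2 * 4 ^
((k - 1) / 2) = 2 ^ k`. -/
lemma integral_coordDensity_eq_incBeta (k : ℕ) {γ δ : ℝ} (h0 : -1 ≤ γ) (h1 : γ ≤ δ) (h2 : δ ≤ 1) :
    ∫ t in γ..δ, coordDensity k t = 2 ^ (k : ℝ) *
      ∫ s in (1 + γ) / 2..(1 + δ) / 2,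
        s ^ (((k : ℝ) + 1) / 2 - 1) * (1 - s) ^ (((k : ℝ) + 1) / 2 - 1) := by
  have hsub := intervalIntegral.integral_comp_mul_sub (a := (1 + γ) / 2) (b := (1 + δ) / 2)
    (coordDensity k) (two_ne_zero' ℝ) 1
  rw [show 2 * ((1 + γ) / 2) - 1 = γ by ring, show 2 * ((1 + δ) / 2) - 1 = δ by ring,
    smul_eq_mul] at hsub
  have h3 : ∫ s in (1 + γ) / 2..(1 + δ) / 2, coordDensity k (2 * s - 1) =
      ∫ s in (1 + γ) / 2..(1 + δ) / 2, 4 ^ (((k : ℝ) - 1) / 2) *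
        (s ^ (((k : ℝ) + 1) / 2 - 1) * (1 - s) ^ (((k : ℝ) + 1) / 2 - 1)) := by
    refine intervalIntegral.integral_congr fun s hs => ?_
    rw [Set.uIcc_of_le (by linarith)] at hs
    have hs0 : 0 ≤ s := by linarith [hs.1]
    have hs1 : 0 ≤ 1 - s := by linarith [hs.2]
    simp only [coordDensity]
    rw [show 1 - (2 * s - 1) ^ 2 = 4 * (s * (1 - s)) by ring,
      Real.mul_rpow (by norm_num) (mul_nonneg hs0 hs1), Real.mul_rpow hs0 hs1,
      show ((k : ℝ) + 1) / 2 - 1 = ((k : ℝ) - 1) / 2 by ring]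
  rw [h3, intervalIntegral.integral_const_mul] at hsub
  have h4 : (2 : ℝ) ^ (k : ℝ) = 2 * 4 ^ (((k : ℝ) - 1) / 2) := by
    rw [show (4 : ℝ) = 2 ^ (2 : ℝ) by norm_num, ← Real.rpow_mul (by norm_num)]
    nth_rw 2 [← Real.rpow_one 2]
    rw [← Real.rpow_add (by norm_num)]
    congr 1
    ring
  rw [h4, mul_assoc, hsub]
  ring

/-! ### Measures and first moments of caps -/

section Caps

variable {d : ℕ}

lemma measurableSet_cap (γ : ℝ) (v : USphere d) : MeasurableSet (cap γ v) :=
  measurableSet_le measurable_const (measurable_inner_sphere _)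

lemma measurableSet_coCap (γ : ℝ) (v : USphere d) : MeasurableSet (coCap γ v) :=
  measurableSet_lt (measurable_inner_sphere _) measurable_const

lemma coCap_eq_compl (γ : ℝ) (v : USphere d) : coCap γ v = (cap γ v)ᶜ := by
  ext u
  simp [coCap, cap]

variable [NeZero d]

omit [NeZero d] in
lemma abs_inner_sphere_le (u v : USphere d) : |inner ℝ (u : Vec d) (v : Vec d)| ≤ 1 := by
  simpa using abs_real_inner_le_norm (u : Vec d) (v : Vec d)

lemma integrable_inner_sphere (v : USphere d) :
    Integrable (fun u : USphere d => inner ℝ (u : Vec d) (v : Vec d)) (unif d) :=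
  integrable_of_bounded_unif (Measurable.aestronglyMeasurable (by fun_prop)) 1
    fun u => abs_inner_sphere_le u v

lemma integral_inner_sphere (v : Vec d) :
    ∫ u : USphere d, inner ℝ (u : Vec d) v ∂(unif d) = 0 := by
  have h : Integrable (fun u : USphere d => (u : Vec d)) (unif d) :=
    integrable_of_bounded_unif (by fun_prop) 1 fun u => (norm_coe_sphere u).le
  have h2 := integral_inner (𝕜 := ℝ) h v
  rw [integral_coe_unif, inner_zero_right] at h2
  have h3 : ∀ u : USphere d, inner ℝ (u : Vec d) v = inner ℝ v (u : Vec d) := fun u =>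
    real_inner_comm _ _
  simp only [h3]
  exact h2

lemma setIntegral_coCap (γ : ℝ) (v : USphere d) :
    ∫ u in coCap γ v, inner ℝ (u : Vec d) (v : Vec d) ∂(unif d) =
      -∫ u in cap γ v, inner ℝ (u : Vec d) (v : Vec d) ∂(unif d) := by
  have h := integral_add_compl (measurableSet_cap γ v) (integrable_inner_sphere v)
  rw [integral_inner_sphere, ← coCap_eq_compl] at h
  linarith

lemma cap_pos {γ : ℝ} (h : γ < 1) (v : USphere d) : 0 < (unif d).real (cap γ v) := by
  refine ENNReal.toReal_pos (ne_of_gt ?_) (measure_ne_top _ _)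
  refine (unif_pos_of_isOpen (s := {u : USphere d | γ < inner ℝ (u : Vec d) (v : Vec d)})
    (isOpen_lt continuous_const (by fun_prop)) ⟨v, ?_⟩).trans_le (measure_mono ?_)
  · simpa using h
  · exact fun u (hu : γ < inner ℝ (u : Vec d) (v : Vec d)) => hu.le

lemma coCap_pos {γ : ℝ} (h : -1 < γ) (v : USphere d) : 0 < (unif d).real (coCap γ v) := by
  refine ENNReal.toReal_pos (ne_of_gt ?_) (measure_ne_top _ _)
  refine unif_pos_of_isOpen (isOpen_lt (by fun_prop) continuous_const) ⟨-v, ?_⟩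
  change inner ℝ (-(v : Vec d)) (v : Vec d) < γ
  simpa [inner_neg_left] using h

lemma cap_add_coCap (γ : ℝ) (v : USphere d) :
    (unif d).real (cap γ v) + (unif d).real (coCap γ v) = 1 := by
  rw [coCap_eq_compl, measureReal_add_measureReal_compl (measurableSet_cap γ v), probReal_univ]

end Caps

/-- All three quantities carry the same unspecified factor `c`, which cancels in the ratios that
make up the normalization constant. -/
lemma exists_cap_integrals (k : ℕ) : ∃ c : ℝ, 0 < c ∧ ∀ (γ : ℝ), 0 < γ → γ < 1 →
    ∀ v : USphere (k + 2),
    (unif (k + 2)).real (cap γ v) = c * (2 ^ (k : ℝ) *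
      (incBeta 1 (((k : ℝ) + 1) / 2) (((k : ℝ) + 1) / 2) -
        incBeta ((1 + γ) / 2) (((k : ℝ) + 1) / 2) (((k : ℝ) + 1) / 2))) ∧
    (unif (k + 2)).real (coCap γ v) = c * (2 ^ (k : ℝ) *
      incBeta ((1 + γ) / 2) (((k : ℝ) + 1) / 2) (((k : ℝ) + 1) / 2)) ∧
    ∫ u in cap γ v, inner ℝ (u : Vec (k + 2)) (v : Vec (k + 2)) ∂(unif (k + 2)) =
      c * ((1 - γ ^ 2) ^ (((k : ℝ) + 1) / 2) / (k + 1)) := by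
  obtain ⟨c, hc, hw, hint⟩ := exists_integral_comp_inner k
  refine ⟨c, hc, fun γ h0 h1 v => ?_⟩
  have hco : ∫ t in (-1)..γ, coordDensity k t = 2 ^ (k : ℝ) *
      incBeta ((1 + γ) / 2) (((k : ℝ) + 1) / 2) (((k : ℝ) + 1) / 2) := by
    rw [integral_coordDensity_eq_incBeta k le_rfl (by linarith) h1.le, incBeta]
    norm_num
  have hfull : ∫ t in (-1)..1, coordDensity k t = 2 ^ (k : ℝ) *
      incBeta 1 (((k : ℝ) + 1) / 2) (((k : ℝ) + 1) / 2) := by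
    rw [integral_coordDensity_eq_incBeta k le_rfl (by norm_num) le_rfl, incBeta]
    norm_num
  have hadd := intervalIntegral.integral_add_adjacent_intervals
    (intervalIntegrable_coordDensity hw le_rfl (by linarith : (-1 : ℝ) ≤ γ) h1.le)
    (intervalIntegrable_coordDensity hw (by linarith) h1.le le_rfl)
  have hcapf : ∀ f : ℝ → ℝ, Measurable f →
      ∫ u in cap γ v, f (inner ℝ (u : Vec (k + 2)) (v : Vec (k + 2))) ∂(unif (k + 2)) =
        c * ∫ t in γ..1, coordDensity k t * f t := fun f hf => by
    rw [← integral_indicator (measurableSet_cap γ v)]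
    refine (hint v ((Set.Ici γ).indicator f) (hf.indicator measurableSet_Ici)).trans ?_
    congr 1
    rw [intervalIntegral.integral_of_le h1.le, integral_Ioc_eq_integral_Ioo (x := γ),
      ← integral_Ico_eq_integral_Ioo (x := γ), show Set.Ico γ 1 = Set.Ioo (-1) 1 ∩ Set.Ici γ by
        ext t
        simp only [Set.mem_Ico, Set.mem_inter_iff, Set.mem_Ioo, Set.mem_Ici]
        constructor
        · exact fun h => ⟨⟨by linarith, h.2⟩, h.1⟩
        · exact fun h => ⟨h.2, h.1.2⟩, ← setIntegral_indicator measurableSet_Ici]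
    congr 1
    funext t
    by_cases ht : t ∈ Set.Ici γ <;> simp [ht]
  have hcap : (unif (k + 2)).real (cap γ v) = c * ∫ t in γ..1, coordDensity k t := by
    simpa using hcapf (fun _ => 1) measurable_const
  have hone : 1 = c * ∫ t in (-1)..1, coordDensity k t := by
    have := hint v (fun _ => 1) measurable_const
    rw [intervalIntegral.integral_of_le (by norm_num), integral_Ioc_eq_integral_Ioo]
    simpa using this
  have hsum := cap_add_coCap γ v
  refine ⟨?_, ?_, ?_⟩
  · rw [hcap, mul_sub, ← hfull, ← hco]
    linear_combination c * hadd
  · rw [← hco]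
    linear_combination hsum - hcap + hone - c * hadd
  · rw [← integral_coordDensity_mul_id hw (by linarith) h1]
    exact hcapf id measurable_id

lemma inner_eq_one_or_neg_one (u v : USphere 1) :
    inner ℝ (u : Vec 1) (v : Vec 1) = 1 ∨ inner ℝ (u : Vec 1) (v : Vec 1) = -1 := by
  have h : ∀ w : USphere 1, (w : Vec 1) 0 ^ 2 = 1 := fun w => by
    have := EuclideanSpace.norm_sq_eq (w : Vec 1)
    simpa using this.symm
  have hi : inner ℝ (u : Vec 1) (v : Vec 1) = (u : Vec 1) 0 * (v : Vec 1) 0 := by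
    simp [PiLp.inner_apply, mul_comm]
  rw [← mul_self_eq_one_iff, hi]
  linear_combination (v : Vec 1) 0 ^ 2 * h u + h v

/-- The normalization constant of PrivUnit is the mean of `⟨V, v⟩`. -/
lemma normConst_eq {d : ℕ} [NeZero d] (p : ℝ) {γ : ℝ} (h0 : 0 < γ) (h1 : γ < 1)
    (v : USphere d) :
    normConst d p γ =
      p * ((∫ u in cap γ v, inner ℝ (u : Vec d) (v : Vec d) ∂(unif d)) /
        (unif d).real (cap γ v)) +
      (1 - p) * ((∫ u in coCap γ v, inner ℝ (u : Vec d) (v : Vec d) ∂(unif d)) /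
        (unif d).real (coCap γ v)) := by
  by_cases hd : d = 1
  -- On `S⁰` the cap is `{v}` and its complement `{-v}`, so the mean is `p - (1 - p)`.
  · subst hd
    have hc := cap_pos h1 v
    have hcc := coCap_pos (by linarith : -1 < γ) v
    have e1 : ∫ u in cap γ v, inner ℝ (u : Vec 1) (v : Vec 1) ∂(unif 1) =
        (unif 1).real (cap γ v) := by
      rw [setIntegral_congr_fun (g := fun _ => (1 : ℝ)) (measurableSet_cap γ v)]
      · simp
      · intro u hu
        refine (inner_eq_one_or_neg_one u v).resolve_right fun h => ?_
        have : γ ≤ inner ℝ (u : Vec 1) (v : Vec 1) := hu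
        linarith
    have e2 : ∫ u in coCap γ v, inner ℝ (u : Vec 1) (v : Vec 1) ∂(unif 1) =
        -(unif 1).real (coCap γ v) := by
      rw [setIntegral_congr_fun (g := fun _ => (-1 : ℝ)) (measurableSet_coCap γ v)]
      · simp
      · intro u hu
        refine (inner_eq_one_or_neg_one u v).resolve_left fun h => ?_
        have : inner ℝ (u : Vec 1) (v : Vec 1) < γ := hu
        linarith
    rw [e1, e2, normConst, if_pos rfl]
    field_simp
    ring
  · obtain ⟨k, rfl⟩ : ∃ k, d = k + 2 := ⟨d - 2, by have := NeZero.ne d; omega⟩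
    obtain ⟨c, hc, hcap⟩ := exists_cap_integrals k
    obtain ⟨e1, e2, e3⟩ := hcap γ h0 h1 v
    have p1 := cap_pos h1 v
    have p2 := coCap_pos (by linarith : -1 < γ) v
    rw [setIntegral_coCap, e3]
    rw [e1] at p1 ⊢
    rw [e2] at p2 ⊢
    rw [normConst, if_neg hd]
    simp only [show (((k + 2 : ℕ) : ℝ) - 1) = (k : ℝ) + 1 by push_cast; ring,
      show (((k + 2 : ℕ) : ℝ) - 2) = (k : ℝ) by push_cast; ring]
    have hk : (0 : ℝ) < (k : ℝ) + 1 := by positivity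
    have h2 : (0 : ℝ) < 2 ^ (k : ℝ) := by positivity
    have q1 := (mul_pos_iff_of_pos_left h2).1 ((mul_pos_iff_of_pos_left hc).1 p1)
    have q2 := (mul_pos_iff_of_pos_left h2).1 ((mul_pos_iff_of_pos_left hc).1 p2)
    field_simp
    ring

/-! ### The optimal threshold -/

section Threshold

variable {d : ℕ} [NeZero d]

omit [NeZero d] in
lemma integral_comp_inner_eq {g : ℝ → ℝ} (hg : Measurable g) (v w : USphere d) :
    ∫ u, g (inner ℝ (u : Vec d) (v : Vec d)) ∂(unif d) =
      ∫ u, g (inner ℝ (u : Vec d) (w : Vec d)) ∂(unif d) := by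
  have h : ∀ x : USphere d, ∫ u, g (inner ℝ (u : Vec d) (x : Vec d)) ∂(unif d) =
      ∫ t, g t ∂((unif d).map fun u : USphere d => inner ℝ (u : Vec d) (x : Vec d)) := fun x =>
    (integral_map (Measurable.aemeasurable (by fun_prop)) hg.aestronglyMeasurable).symm
  rw [h v, h w, map_inner_unif v w]

omit [NeZero d] in
lemma cap_real_eq (γ : ℝ) (v w : USphere d) :
    (unif d).real (cap γ v) = (unif d).real (cap γ w) := by
  have h : ∀ x : USphere d, (unif d) (cap γ x) =
      ((unif d).map fun u : USphere d => inner ℝ (u : Vec d) (x : Vec d)) (Set.Ici γ) := fun x =>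
    (Measure.map_apply (measurable_inner_sphere (x : Vec d)) measurableSet_Ici).symm
  rw [Measure.real, Measure.real, h v, h w, map_inner_unif v w]

lemma integrable_max_inner_sub (γ : ℝ) (v : USphere d) :
    Integrable (fun u : USphere d => max (inner ℝ (u : Vec d) (v : Vec d) - γ) 0) (unif d) :=
  ((integrable_inner_sphere v).sub (integrable_const γ)).pos_part

lemma integral_max_inner_pos (v : USphere d) :
    0 < ∫ u, max (inner ℝ (u : Vec d) (v : Vec d) - 0) 0 ∂(unif d) := by
  have h1 : ∫ u, (cap (1 / 2) v).indicator (fun _ => (1 / 2 : ℝ)) u ∂(unif d) ≤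
      ∫ u, max (inner ℝ (u : Vec d) (v : Vec d) - 0) 0 ∂(unif d) := by
    refine integral_mono ((integrable_const _).indicator (measurableSet_cap _ v))
      (integrable_max_inner_sub 0 v) fun u => ?_
    by_cases hu : u ∈ cap (1 / 2) v
    · rw [Set.indicator_of_mem hu]
      have hu' : 1 / 2 ≤ inner ℝ (u : Vec d) (v : Vec d) := hu
      exact le_max_of_le_left (by linarith)
    · rw [Set.indicator_of_notMem hu]
      exact le_max_right _ _
  rw [integral_indicator (measurableSet_cap _ v), setIntegral_const, smul_eq_mul] at h1
  have h2 := cap_pos (by norm_num : (1 / 2 : ℝ) < 1) v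
  linarith

/-- Intermediate value theorem: left minus right is positive at `0` and `-1` at `1`. The equation
says that the density proportional to `a` on the cap and `1` off it gives `⟨u, v⟩` the mean `γ`. -/
lemma exists_threshold {a : ℝ} (ha : 1 < a) : ∃ γ : ℝ, 0 < γ ∧ γ < 1 ∧ ∀ v : USphere d,
    (a - 1) * ∫ u, max (inner ℝ (u : Vec d) (v : Vec d) - γ) 0 ∂(unif d) = γ := by
  obtain ⟨e⟩ := (inferInstance : Nonempty (USphere d))
  let F : ℝ → ℝ := fun γ =>
    (a - 1) * ∫ u, max (inner ℝ (u : Vec d) (e : Vec d) - γ) 0 ∂(unif d) - γ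
  have hcont : ContinuousOn F (Set.Icc 0 1) := by
    refine ContinuousOn.sub (continuousOn_const.mul ?_) continuousOn_id
    refine continuousOn_of_dominated (bound := fun _ => 1)
      (fun γ _ => (integrable_max_inner_sub γ e).1) (fun γ hγ => .of_forall fun u => ?_)
      (integrable_const _) (.of_forall fun u => by fun_prop)
    have := (abs_le.1 (abs_inner_sphere_le u e)).2
    rw [Real.norm_of_nonneg (le_max_right _ _)]
    exact max_le (by linarith [hγ.1]) zero_le_one
  have hF0 : 0 < F 0 := by
    have := mul_pos (sub_pos.2 ha) (integral_max_inner_pos e)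
    simpa [F] using this
  have hF1 : F 1 = -1 := by
    have : ∀ u : USphere d, max (inner ℝ (u : Vec d) (e : Vec d) - 1) 0 = 0 := fun u =>
      max_eq_right (by linarith [(abs_le.1 (abs_inner_sphere_le u e)).2])
    simp [F, this]
  obtain ⟨γ, ⟨h0, h1⟩, hγ⟩ := intermediate_value_Icc' zero_le_one hcont
    (show (0 : ℝ) ∈ Set.Icc (F 1) (F 0) from ⟨by rw [hF1]; norm_num, hF0.le⟩)
  refine ⟨γ, lt_of_le_of_ne h0 ?_, lt_of_le_of_ne h1 ?_, fun v => ?_⟩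
  · rintro rfl
    exact hF0.ne' hγ
  · rintro rfl
    rw [hF1] at hγ
    norm_num at hγ
  · rw [integral_comp_inner_eq (g := fun t => max (t - γ) 0) (by fun_prop) v e]
    exact sub_eq_zero.1 hγ

lemma integral_max_inner_sub (γ : ℝ) (v : USphere d) :
    ∫ u, max (inner ℝ (u : Vec d) (v : Vec d) - γ) 0 ∂(unif d) =
      ∫ u in cap γ v, inner ℝ (u : Vec d) (v : Vec d) ∂(unif d) -
        γ * (unif d).real (cap γ v) := by
  have h : ∀ u : USphere d, max (inner ℝ (u : Vec d) (v : Vec d) - γ) 0 =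
      (cap γ v).indicator (fun u : USphere d => inner ℝ (u : Vec d) (v : Vec d) - γ) u := by
    intro u
    by_cases hu : u ∈ cap γ v
    · rw [Set.indicator_of_mem hu]
      have hu' : γ ≤ inner ℝ (u : Vec d) (v : Vec d) := hu
      exact max_eq_left (by linarith)
    · rw [Set.indicator_of_notMem hu]
      have hu' : ¬ γ ≤ inner ℝ (u : Vec d) (v : Vec d) := hu
      exact max_eq_right (by linarith)
  simp only [h]
  rw [integral_indicator (measurableSet_cap γ v),
    integral_sub (integrable_inner_sphere v).integrableOn (integrable_const γ),
    setIntegral_const, smul_eq_mul, mul_comm]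

/-- A function whose values differ by a factor of at most `a` correlates with a coordinate by at
most the optimal threshold. -/
lemma integral_inner_mul_le {a γ : ℝ} (v : USphere d)
    (hγ : (a - 1) * ∫ u, max (inner ℝ (u : Vec d) (v : Vec d) - γ) 0 ∂(unif d) = γ)
    (ha : 1 < a) {r : USphere d → ℝ} (hr : Measurable r) (hr0 : ∀ u, 0 ≤ r u)
    (hr1 : ∀ u, r u ≤ 1) (hra : ∀ u w, r u ≤ a * r w) :
    ∫ u, inner ℝ (u : Vec d) (v : Vec d) * r u ∂(unif d) ≤ γ * ∫ u, r u ∂(unif d) := by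
  set c := ⨅ u, r u
  have hbdd : BddBelow (Set.range r) := ⟨0, by rintro _ ⟨u, rfl⟩; exact hr0 u⟩
  have hc1 : ∀ u, c ≤ r u := fun u => ciInf_le hbdd u
  have hc2 : ∀ u, r u ≤ a * c := fun u => by
    have : a⁻¹ * r u ≤ c := le_ciInf fun w => by
      rw [inv_mul_le_iff₀ (by linarith)]
      exact hra u w
    rwa [inv_mul_le_iff₀ (by linarith)] at this
  have hri : Integrable r (unif d) :=
    integrable_of_bounded_unif hr.aestronglyMeasurable 1 fun u => by
      rw [Real.norm_of_nonneg (hr0 u)]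
      exact hr1 u
  have hti : Integrable (fun u : USphere d => inner ℝ (u : Vec d) (v : Vec d) * r u) (unif d) :=
    hri.bdd_mul (Measurable.aestronglyMeasurable (by fun_prop))
      (.of_forall fun u => abs_inner_sphere_le u v)
  -- Bang-bang bound: `(t - γ) r` is largest with `r = a c` where `t ≥ γ` and `r = c` elsewhere. On
  -- integrating, the linear part gives `-c γ` and the positive part `c γ` by the choice of `γ`, so
  -- the total is zero.
  have hle : ∀ u : USphere d, inner ℝ (u : Vec d) (v : Vec d) * r u - γ * r u ≤
      c * inner ℝ (u : Vec d) (v : Vec d) - c * γ +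
        c * (a - 1) * max (inner ℝ (u : Vec d) (v : Vec d) - γ) 0 := by
    intro u
    rcases le_total γ (inner ℝ (u : Vec d) (v : Vec d)) with h | h
    · rw [max_eq_left (by linarith)]
      nlinarith [mul_le_mul_of_nonneg_left (hc2 u) (sub_nonneg.2 h)]
    · rw [max_eq_right (by linarith)]
      nlinarith [mul_le_mul_of_nonneg_left (hc1 u) (sub_nonneg.2 h)]
  have hi1 : Integrable (fun u : USphere d => c * inner ℝ (u : Vec d) (v : Vec d) - c * γ)
      (unif d) := ((integrable_inner_sphere v).const_mul c).sub (integrable_const _)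
  have hi2 := (integrable_max_inner_sub γ v).const_mul (c * (a - 1))
  have h := integral_mono (hti.sub (hri.const_mul γ)) (hi1.add hi2) hle
  simp only [Pi.sub_apply, Pi.add_apply] at h
  rw [integral_sub hti (hri.const_mul γ), integral_add hi1 hi2,
    integral_sub ((integrable_inner_sphere v).const_mul c) (integrable_const _),
    integral_const_mul, integral_const_mul, integral_const_mul (c * (a - 1)),
    integral_inner_sphere, mul_assoc c, hγ] at h
  simp only [integral_const, probReal_univ, one_smul, mul_zero] at h
  linarith

end Threshold

/-! ### Additive aggregation of spherical unbiased randomizers -/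

section Additive

variable {d n : ℕ}

lemma outputLaw_additive (K : Kernel (USphere d) (Vec d)) (v : Fin n → USphere d) :
    outputLaw (additive d n) K v =
      (Measure.pi fun i => K (v i)).map fun z => (n : ℝ)⁻¹ • ∑ i, z i :=
  Measure.bind_dirac_eq_map _ (by fun_prop)

variable {K : Kernel (USphere d) (Vec d)} [IsMarkovKernel K]

lemma isUnbiased_additive (hK : ∀ v, Integrable (fun z => z) (K v))
    (hmean : ∀ v, ∫ z, z ∂(K v) = v) : IsUnbiased (additive d n) K := by
  intro v
  have hm : Measurable fun z : Fin n → Vec d => (n : ℝ)⁻¹ • ∑ i, z i := by fun_prop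
  have hi : ∀ i, Integrable (fun z : Fin n → Vec d => z i) (Measure.pi fun i => K (v i)) :=
    fun i => integrable_comp_eval (μ := fun i => K (v i)) (i := i) (f := fun z => z) (hK (v i))
  rw [outputLaw_additive]
  constructor
  · exact (integrable_map_measure (g := fun x : Vec d => x) (by fun_prop) hm.aemeasurable).2
      (Integrable.smul (n : ℝ)⁻¹ (integrable_finsetSum Finset.univ fun i _ => hi i))
  · rw [integral_map hm.aemeasurable (by fun_prop), integral_smul,
      integral_finsetSum _ fun i _ => hi i, meanVec]
    congr 1
    refine Finset.sum_congr rfl fun i _ => ?_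
    rw [integral_comp_eval (μ := fun i => K (v i)) (i := i) (f := fun z => z) (by fun_prop),
      hmean]

/-- The error of additive aggregation of unbiased messages of norm `b`. -/
lemma err_additive_le {b : ℝ} (hK : ∀ v, ∀ᵐ z ∂(K v), ‖z‖ = b)
    (hmean : ∀ v, ∫ z, z ∂(K v) = v) :
    err (additive d n) K ≤ ENNReal.ofReal ((b ^ 2 - 1) / n) := by
  refine iSup_le fun v => ?_
  have hm : Measurable fun z : Fin n → Vec d => (n : ℝ)⁻¹ • ∑ i, z i := by fun_prop
  have hL : ∀ w, MemLp (fun z => z) 2 (K w) := fun w =>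
    MemLp.of_bound (by fun_prop) b ((hK w).mono fun z hz => hz.le)
  have hi : ∀ w, Integrable (fun z => z) (K w) := fun w => (hL w).integrable one_le_two
  have hL' : ∀ w : USphere d, MemLp (fun z => z - (w : Vec d)) 2 (K w) := fun w =>
    (hL w).sub (memLp_const _)
  -- A message of norm `b` and mean `w` has variance `b² - 2⟨w, w⟩ + ‖w‖²`.
  have hvar : ∀ w : USphere d, ∫ z, ‖z - (w : Vec d)‖ ^ 2 ∂(K w) = b ^ 2 - 1 := fun w => by
    rw [integral_norm_sub_sq (hL w) (memLp_const _)]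
    have h1 : ∫ z, ‖z‖ ^ 2 ∂(K w) = b ^ 2 := by
      rw [integral_congr_ae (g := fun _ => b ^ 2) ((hK w).mono fun z hz => by simp only [hz])]
      simp
    have h2 : ∫ z, inner ℝ z (w : Vec d) ∂(K w) = 1 := by
      have h3 := integral_inner (𝕜 := ℝ) (hi w) (w : Vec d)
      rw [hmean, real_inner_self_eq_norm_sq, norm_coe_sphere, one_pow] at h3
      exact (integral_congr_ae (.of_forall fun z => real_inner_comm _ _)).trans h3
    rw [h1, h2]
    simp
    ring
  have hsum := integral_norm_sum_sq (fun i => K (v i)) (fun i z => z - (v i : Vec d))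
    (fun i => by fun_prop) (fun i => hL' (v i)) fun i => by
      rw [integral_sub (hi _) (integrable_const _), hmean]
      simp
  have heq : ∀ z : Fin n → Vec d, ‖(n : ℝ)⁻¹ • ∑ i, z i - meanVec v‖ ^ 2 =
      (n : ℝ)⁻¹ ^ 2 * ‖∑ i, (z i - (v i : Vec d))‖ ^ 2 := fun z => by
    rw [meanVec, ← smul_sub, ← Finset.sum_sub_distrib, norm_smul, mul_pow, Real.norm_eq_abs,
      sq_abs]
  have hint : Integrable (fun z : Fin n → Vec d => ‖∑ i, (z i - (v i : Vec d))‖ ^ 2)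
      (Measure.pi fun i => K (v i)) :=
    (memLp_finsetSum _ fun i _ => (hL' (v i)).comp_measurePreserving
      (measurePreserving_eval (fun i => K (v i)) i)).norm.integrable_sq
  rw [outputLaw_additive, lintegral_map (by fun_prop) hm]
  simp only [heq]
  rw [← ofReal_integral_eq_lintegral_ofReal (hint.const_mul _) (.of_forall fun z => by positivity),
    integral_const_mul, hsum]
  refine ENNReal.ofReal_le_ofReal (le_of_eq ?_)
  simp only [hvar, Finset.sum_const, Finset.card_univ, Fintype.card_fin, nsmul_eq_mul]
  rcases Nat.eq_zero_or_pos n with rfl | hn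
  · simp
  · field_simp

end Additive

/-! ### PrivUnit at the optimal threshold -/

section PrivUnit

variable {d : ℕ} [NeZero d]

/-- The total weight `a P(cap) + P(coCap)` of a density taking the value `a` on the cap and `1`
on its complement. -/
noncomputable def capWeight (a γ : ℝ) (v : USphere d) : ℝ := 1 + (a - 1) * (unif d).real (cap γ v)

/-- The probability of the cap under the density proportional to `a` on the cap and `1` on its
complement. -/
noncomputable def capProb (a γ : ℝ) (v : USphere d) : ℝ :=
  a * (unif d).real (cap γ v) / capWeight a γ v

variable {a γ : ℝ}

omit [NeZero d] in
lemma capWeight_pos (ha : 1 < a) (v : USphere d) : 0 < capWeight a γ v := by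
  have : 0 ≤ (a - 1) * (unif d).real (cap γ v) := mul_nonneg (by linarith) measureReal_nonneg
  rw [capWeight]
  linarith

lemma one_sub_capProb (ha : 1 < a) (v : USphere d) :
    1 - capProb a γ v = (unif d).real (coCap γ v) / capWeight a γ v := by
  have h := (capWeight_pos (γ := γ) ha v).ne'
  have h2 := cap_add_coCap γ v
  rw [capProb, eq_div_iff h, sub_mul, div_mul_cancel₀ _ h, capWeight]
  linarith

lemma capProb_mem_Icc (ha : 1 < a) (v : USphere d) : capProb a γ v ∈ Set.Icc (0 : ℝ) 1 := by
  have h := capWeight_pos (γ := γ) ha v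
  refine ⟨div_nonneg (mul_nonneg (by linarith) measureReal_nonneg) h.le, ?_⟩
  rw [← sub_nonneg, one_sub_capProb ha]
  exact div_nonneg measureReal_nonneg h.le

omit [NeZero d] in
lemma capProb_eq (v w : USphere d) : capProb a γ v = capProb a γ w := by
  rw [capProb, capProb, capWeight, capWeight, cap_real_eq γ v w]

/-- The weight of the density of the optimal threshold, as a multiple of its first moment. -/
lemma threshold_mul_capWeight (v : USphere d)
    (hγ : (a - 1) * ∫ u, max (inner ℝ (u : Vec d) (v : Vec d) - γ) 0 ∂(unif d) = γ) :
    (a - 1) * ∫ u in cap γ v, inner ℝ (u : Vec d) (v : Vec d) ∂(unif d) =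
      γ * capWeight a γ v := by
  rw [integral_max_inner_sub] at hγ
  rw [capWeight]
  linear_combination hγ

/-- The normalizer is the mean of `⟨V, v⟩`, and the fixed-point equation says that this mean is the
threshold. -/
lemma normConst_capProb (ha : 1 < a) (h0 : 0 < γ) (h1 : γ < 1) (v : USphere d)
    (hγ : (a - 1) * ∫ u, max (inner ℝ (u : Vec d) (v : Vec d) - γ) 0 ∂(unif d) = γ) :
    normConst d (capProb a γ v) γ = γ := by
  have p1 := cap_pos h1 v
  have p2 := coCap_pos (by linarith : -1 < γ) v
  have hw := capWeight_pos (γ := γ) ha v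
  rw [normConst_eq _ h0 h1 v, one_sub_capProb ha, setIntegral_coCap, capProb]
  have h := threshold_mul_capWeight v hγ
  field_simp
  linear_combination h

/-- The law of the point drawn by PrivUnit, before rescaling. -/
noncomputable def capLaw (p γ : ℝ) (v : USphere d) : Measure (USphere d) :=
  ENNReal.ofReal p • (surf d)[|cap γ v] + ENNReal.ofReal (1 - p) • (surf d)[|coCap γ v]

lemma ofReal_smul_cond (q : ℝ) {s : Set (USphere d)} (hs : 0 < (unif d).real s) :
    ENNReal.ofReal (q * (unif d).real s) • (surf d)[|s] =
      ENNReal.ofReal q • (unif d).restrict s := by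
  rw [← cond_unif, ProbabilityTheory.cond, smul_smul, ENNReal.ofReal_mul' hs.le, mul_assoc,
    ofReal_measureReal, ENNReal.mul_inv_cancel, mul_one]
  · intro h
    simp [Measure.real, h] at hs
  · exact measure_ne_top _ _

/-- With `p = capProb a γ v` the density takes two values whose ratio is exactly `a`, the extremal
case of the lower bound. -/
lemma capLaw_capProb (ha : 1 < a) (h0 : 0 < γ) (h1 : γ < 1) (v : USphere d) :
    capLaw (capProb a γ v) γ v =
      ENNReal.ofReal (a / capWeight a γ v) • (unif d).restrict (cap γ v) +
        ENNReal.ofReal (1 / capWeight a γ v) • (unif d).restrict (coCap γ v) := by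
  rw [capLaw, one_sub_capProb ha, ← ofReal_smul_cond _ (cap_pos h1 v),
    ← ofReal_smul_cond _ (coCap_pos (by linarith : -1 < γ) v), capProb]
  congr 3
  · ring
  · ring

lemma isProbabilityMeasure_capLaw {p : ℝ} (hp : p ∈ Set.Icc (0 : ℝ) 1) (h0 : 0 < γ) (h1 : γ < 1)
    (v : USphere d) : IsProbabilityMeasure (capLaw p γ v) := by
  have hne : ∀ {s : Set (USphere d)}, 0 < (unif d).real s → (unif d) s ≠ 0 := fun hs h => by
    simp [Measure.real, h] at hs
  have i1 := cond_isProbabilityMeasure (hne (cap_pos h1 v))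
  have i2 := cond_isProbabilityMeasure (hne (coCap_pos (by linarith : -1 < γ) v))
  rw [cond_unif] at i1 i2
  refine ⟨?_⟩
  simp only [capLaw, Measure.add_apply, Measure.smul_apply, measure_univ, smul_eq_mul, mul_one]
  rw [← ENNReal.ofReal_add hp.1 (by linarith [hp.2])]
  simp

/-- Privacy follows by comparing two inputs through `unif`, since `capWeight` does not depend on the
input. -/
lemma capLaw_bounds (ha : 1 < a) (h0 : 0 < γ) (h1 : γ < 1) (v : USphere d)
    {E : Set (USphere d)} (hE : MeasurableSet E) :
    ENNReal.ofReal (1 / capWeight a γ v) * unif d E ≤ capLaw (capProb a γ v) γ v E ∧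
      capLaw (capProb a γ v) γ v E ≤ ENNReal.ofReal (a / capWeight a γ v) * unif d E := by
  have hw := capWeight_pos (γ := γ) ha v
  have hsplit : unif d E = (unif d).restrict (cap γ v) E + (unif d).restrict (coCap γ v) E := by
    rw [Measure.restrict_apply hE, Measure.restrict_apply hE, coCap_eq_compl,
      ← Set.sdiff_eq, measure_inter_add_sdiff _ (measurableSet_cap γ v)]
  have hle : ENNReal.ofReal (1 / capWeight a γ v) ≤ ENNReal.ofReal (a / capWeight a γ v) :=
    ENNReal.ofReal_le_ofReal (by gcongr)
  rw [capLaw_capProb ha h0 h1, hsplit, Measure.add_apply, Measure.smul_apply, Measure.smul_apply,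
    smul_eq_mul, smul_eq_mul, mul_add, mul_add]
  exact ⟨by gcongr, by gcongr⟩

/-- By symmetry the mean is along `v`. The complement contributes the opposite of the cap's vector
integral, leaving `(a - 1) / capWeight` times the cap's first moment. -/
lemma integral_capLaw_capProb (ha : 1 < a) (h0 : 0 < γ) (h1 : γ < 1) (v : USphere d)
    (hγ : (a - 1) * ∫ u, max (inner ℝ (u : Vec d) (v : Vec d) - γ) 0 ∂(unif d) = γ) :
    ∫ u, (u : Vec d) ∂(capLaw (capProb a γ v) γ v) = γ • (v : Vec d) := by
  have hw := capWeight_pos (γ := γ) ha v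
  have hi : Integrable (fun u : USphere d => (u : Vec d)) (unif d) :=
    integrable_of_bounded_unif (by fun_prop) 1 fun u => (norm_coe_sphere u).le
  have hcap : ∫ u in cap γ v, (u : Vec d) ∂(unif d) =
      (∫ u in cap γ v, inner ℝ (u : Vec d) (v : Vec d) ∂(unif d)) • (v : Vec d) := by
    rw [← integral_indicator (measurableSet_cap γ v), ← integral_indicator (measurableSet_cap γ v)]
    have h := integral_inner_smul ((Set.Ici γ).indicator fun _ => (1 : ℝ))
      (measurable_const.indicator measurableSet_Ici) 1 (fun t => by
        by_cases ht : t ∈ Set.Ici γ <;> simp [ht]) v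
    have hmem : ∀ u : USphere d, inner ℝ (u : Vec d) (v : Vec d) ∈ Set.Ici γ ↔ u ∈ cap γ v :=
      fun u => Iff.rfl
    refine Eq.trans ?_ (h.trans ?_)
    · refine integral_congr_ae (.of_forall fun u => ?_)
      by_cases hu : u ∈ cap γ v <;> simp [Set.indicator, hu] <;> simp_all
    · congr 1
      refine integral_congr_ae (.of_forall fun u => ?_)
      by_cases hu : u ∈ cap γ v <;> simp_all [Set.indicator]
  have hco : ∫ u in coCap γ v, (u : Vec d) ∂(unif d) = -∫ u in cap γ v, (u : Vec d) ∂(unif d) := by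
    have h := integral_add_compl (measurableSet_cap γ v) hi
    rw [integral_coe_unif, ← coCap_eq_compl] at h
    exact (neg_eq_of_add_eq_zero_right h).symm
  rw [capLaw_capProb ha h0 h1, integral_add_measure
    (hi.integrableOn.smul_measure ENNReal.ofReal_ne_top)
    (hi.integrableOn.smul_measure ENNReal.ofReal_ne_top), integral_smul_measure,
    integral_smul_measure, hco, hcap, ENNReal.toReal_ofReal (div_nonneg (by linarith) hw.le),
    ENNReal.toReal_ofReal (by positivity), smul_neg, ← sub_eq_add_neg, ← sub_smul, smul_smul]
  congr 1
  have h := threshold_mul_capWeight v hγ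
  field_simp
  linear_combination h

/-- The parameters of PrivUnit attached to the optimal threshold `γ` give a private, unbiased
randomizer with messages of norm `γ⁻¹`. -/
lemma privUnit_capProb {ε : ℝ} (hε : 0 < ε) (h0 : 0 < γ) (h1 : γ < 1)
    (hγ : ∀ v : USphere d, (Real.exp ε - 1) *
      ∫ u, max (inner ℝ (u : Vec d) (v : Vec d) - γ) 0 ∂(unif d) = γ) (e : USphere d) :
    IsDPLocalRandomizer ε (privUnit d (capProb (Real.exp ε) γ e) γ) ∧
      (∀ v, ∀ᵐ z ∂(privUnit d (capProb (Real.exp ε) γ e) γ v), ‖z‖ = γ⁻¹) ∧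
      ∀ v, ∫ z, z ∂(privUnit d (capProb (Real.exp ε) γ e) γ v) = v := by
  have ha : 1 < Real.exp ε := Real.one_lt_exp_iff.2 hε
  set a := Real.exp ε with ha_def
  have hm : Measurable fun u : USphere d => γ⁻¹ • (u : Vec d) := by fun_prop
  have hlaw : ∀ v, privUnit d (capProb a γ e) γ v =
      (capLaw (capProb a γ v) γ v).map fun u : USphere d => γ⁻¹ • (u : Vec d) := fun v => by
    have hN := normConst_capProb ha h0 h1 e (hγ e)
    change privUnitLaw _ _ _ = _
    rw [privUnitLaw, hN, capProb_eq e v]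
    rfl
  have hprob : ∀ v : USphere d, IsProbabilityMeasure (capLaw (capProb a γ v) γ v) := fun v =>
    isProbabilityMeasure_capLaw (capProb_mem_Icc ha v) h0 h1 v
  refine ⟨⟨⟨fun v => ?_⟩, fun v w E hE => ?_⟩, fun v => ?_, fun v => ?_⟩
  · rw [hlaw]
    exact Measure.isProbabilityMeasure_map hm.aemeasurable
  · rw [hlaw, hlaw, Measure.map_apply hm hE, Measure.map_apply hm hE]
    set E' := (fun u : USphere d => γ⁻¹ • (u : Vec d)) ⁻¹' E
    obtain ⟨lv, uv⟩ := capLaw_bounds ha h0 h1 v (hm hE)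
    obtain ⟨lw, uw⟩ := capLaw_bounds ha h0 h1 w (hm hE)
    have hww : capWeight a γ v = capWeight a γ w := by
      rw [capWeight, capWeight, cap_real_eq γ v w]
    have hmul : ENNReal.ofReal (a / capWeight a γ w) =
        ENNReal.ofReal a * ENNReal.ofReal (1 / capWeight a γ w) := by
      rw [← ENNReal.ofReal_mul (by linarith), mul_one_div]
    have hinv : ENNReal.ofReal (Real.exp (-ε)) * ENNReal.ofReal a = 1 := by
      rw [← ENNReal.ofReal_mul (Real.exp_nonneg _), ha_def, ← Real.exp_add]
      simp
    rw [hww] at lv uv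
    rw [hmul] at uv uw
    constructor
    · refine (mul_le_mul_right uv _).trans ?_
      rw [mul_assoc, ← mul_assoc, hinv, one_mul]
      exact lw
    · refine uw.trans ?_
      rw [mul_assoc]
      exact mul_le_mul_right lv _
  · rw [hlaw, ae_map_iff hm.aemeasurable (measurableSet_eq_fun (by fun_prop) (by fun_prop))]
    refine .of_forall fun u => ?_
    rw [norm_smul, norm_coe_sphere, mul_one, norm_inv, Real.norm_of_nonneg h0.le]
  · rw [hlaw, integral_map hm.aemeasurable (by fun_prop), integral_smul,
      integral_capLaw_capProb ha h0 h1 v (hγ v), smul_smul, inv_mul_cancel₀ h0.ne', one_smul]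

end PrivUnit

/-! ### Optimality -/

/-- A randomizer that admits an unbiased aggregation has a positive privacy parameter. -/
lemma pos_of_isUnbiased {d n : ℕ} [NeZero d] (hn : n ≠ 0) {ε : ℝ} {Y : Type*} [MeasurableSpace Y]
    {R : Kernel (USphere d) Y} (hR : IsDPLocalRandomizer ε R)
    {A : Kernel (Fin n → Y) (Vec d)} (hA : IsUnbiased A R) : 0 < ε := by
  obtain ⟨e⟩ := (inferInstance : Nonempty (USphere d))
  have := hR.1
  by_contra hε
  have hexp : ENNReal.ofReal (Real.exp ε) ≤ 1 := by
    rw [ENNReal.ofReal_le_one]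
    exact Real.exp_le_one_iff.2 (not_lt.1 hε)
  -- For `ε ≤ 0` each law is dominated by every other, so the messages carry no information; yet the
  -- inputs `e` and `-e` require different output means.
  have hconst : ∀ v w, R v = R w := fun v w => Measure.ext fun E hE =>
    le_antisymm (((hR.2 w v E hE).2.trans (mul_le_mul_left hexp _)).trans_eq (one_mul _))
      (((hR.2 v w E hE).2.trans (mul_le_mul_left hexp _)).trans_eq (one_mul _))
  have hlaw : outputLaw A R (fun _ => e) = outputLaw A R (fun _ => -e) := by
    simp only [outputLaw, hconst e (-e)]
  have h : meanVec (n := n) (fun _ => e) = meanVec (n := n) (fun _ => -e) := by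
    rw [← (hA _).2, ← (hA _).2, hlaw]
  have hn' : (n : ℝ) ≠ 0 := Nat.cast_ne_zero.2 hn
  have hmean : ∀ x : USphere d, meanVec (n := n) (fun _ => x) = x := fun x => by
    rw [meanVec, Finset.sum_const, Finset.card_univ, Fintype.card_fin, ← Nat.cast_smul_eq_nsmul ℝ,
      smul_smul, inv_mul_cancel₀ hn', one_smul]
  rw [hmean, hmean] at h
  exact ne_neg_of_mem_unit_sphere ℝ e (Subtype.ext h)

end PrivateMean

theorem mainTheorem1 (d n : ℕ) (hd : 1 ≤ d) (hn : 1 ≤ n) (ε : ℝ)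
    {Y : Type*} [MeasurableSpace Y]
    (R : Kernel (PrivateMean.USphere d) Y) (hR : PrivateMean.IsDPLocalRandomizer ε R)
    (A : Kernel (Fin n → Y) (PrivateMean.Vec d)) [IsMarkovKernel A]
    (hA : PrivateMean.IsUnbiased A R) :
    ∃ p ∈ Set.Icc (0 : ℝ) 1, ∃ γ ∈ Set.Icc (0 : ℝ) 1,
      PrivateMean.IsDPLocalRandomizer ε (PrivateMean.privUnit d p γ) ∧
      PrivateMean.normConst d p γ ≠ 0 ∧
      PrivateMean.IsUnbiased (PrivateMean.additive d n) (PrivateMean.privUnit d p γ) ∧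
      PrivateMean.err (PrivateMean.additive d n) (PrivateMean.privUnit d p γ) ≤
        PrivateMean.err A R := by
  have : NeZero d := ⟨by omega⟩
  have hn0 : n ≠ 0 := by omega
  have := hR.1
  have hε := PrivateMean.pos_of_isUnbiased hn0 hR hA
  have ha : 1 < Real.exp ε := Real.one_lt_exp_iff.2 hε
  obtain ⟨e⟩ := (inferInstance : Nonempty (PrivateMean.USphere d))
  obtain ⟨γ, h0, h1, hγ⟩ := PrivateMean.exists_threshold (d := d) ha
  obtain ⟨hDP, hnorm, hmean⟩ := PrivateMean.privUnit_capProb hε h0 h1 hγ e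
  have := hDP.1
  refine ⟨_, PrivateMean.capProb_mem_Icc ha e, γ, ⟨h0.le, h1.le⟩, hDP, ?_, ?_, ?_⟩
  · rw [PrivateMean.normConst_capProb ha h0 h1 e (hγ e)]
    exact h0.ne'
  · exact PrivateMean.isUnbiased_additive (fun v => Integrable.of_bound (by fun_prop) γ⁻¹
      ((hnorm v).mono fun z hz => hz.le)) hmean
  -- The two bounds meet: messages of norm `b = γ⁻¹` above, correlation bound `m = γ` below.
  · refine (PrivateMean.err_additive_le hnorm hmean).trans
      (PrivateMean.le_err_of_correlation_le hn0 hA h0 fun u E hE => ?_)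
    refine PrivateMean.integral_inner_mul_le u (hγ u) ha (R.measurable_coe hE).ennreal_toReal
      (fun _ => measureReal_nonneg) (fun _ => measureReal_le_one) fun v w => ?_
    have h := ENNReal.toReal_mono (ENNReal.mul_ne_top ENNReal.ofReal_ne_top (measure_ne_top _ _))
      (hR.2 w v E hE).2
    rwa [ENNReal.toReal_mul, ENNReal.toReal_ofReal (Real.exp_nonneg _)] at h
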